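/- Conventions. Composition is in diagrammatic order. A restriction category is a category with an assignment $(f:X\to Y)\mapsto(\overline{f}:X\to X)$ satisfying [R.1] $\overline f f=f$; [R.2] $\overline f\,\overline g=\overline g\,\overline f$; [R.3] $\overline{\overline f g}=\overline f\,\overline g$; [R.4] $f\overline g=\overline{fg}\,f$. A map is total if $\overline f=1$, and $f\le g$ means $\overline f g=f$. A Cartesian restriction category is a restriction category with a chosen object $1$ such that each $X$ has a unique total map $!_X:X\to 1$, with $f\,!_Y=\overline f\,!_X$ for all $f:X\to Y$, and with chosen objects $X\times Y$ and total projections $\pi_0,\pi_1$ such that for all $f:Z\to X$, $g:Z\to Y$ there is a unique $\langle f,g\rangle:Z\to X\times Y$ with $\langle f,g\rangle\pi_0\le f$, $\langle f,g\rangle\pi_1\le g$ and $\overline{\langle f,g\rangle}=\overline f\,\overline g$. For a commutative monoid $(A,+,0)$ in such a category whose structure maps are total, and $f,g:Z\to A$, write $f+g:=\langle f,g\rangle+$ and $0:=\,!_Z0:Z\to A$. Write $A^n\times X=A\times(\cdots\times(A\times X))$, with projections $\pi_0,\dots,\pi_{n-1}$ to $A$ and $\pi_n$ to $X$. **Theorem.**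 Let $\mathbb X$ be a Cartesian restriction category. Then the following data are well defined and form a Cartesian restriction category $\mathrm{Fa\grave a}(\mathbb X)$. - Objects: pairs $((A,+,0),X)$ with $(A,+,0)$ a total commutative monoid in $\mathbb X$ and $X$ an object of $\mathbb X$. - Maps $((A,+,0),X)\to((B,+,0),Y)$: sequences $(f_*,f_1,f_2,\dots)$ with $f_*:X\to Y$ and, for $n\ge1$, $f_n:A^n\times X\to B$ such that $\overline{f_n}=\overline{\pi_nf_*}$ and $f_n$ is symmetric and additive in its first $n$ variables. Additive means that, for all maps $a_0,\dots,a_{n-1},b:Z\to A$, $x:Z\to X$ and each $i<n$, $\langle\dots,a_i+b,\dots,x\rangle f_n=\langle\dots,a_i,\dots,x\rangle f_n+\langle\dots,b,\dots,x\rangle f_n$ and $\langle\dots,0,\dots,x\rangle f_n=\overline{\langle\dots,0,\dots,x\rangle f_n}\,0$ (the displayed entry being the $i$-th). - Identities: $(1,\pi_0,0,0,\dots)$. - Composition: $(fg)_*=f_*g_*$ and, for $n\ge1$, $(fg)_n=\sum_\tau\langle p_1f_{i_1},\dots,p_kf_{i_k},\pi_nf_*\rangle g_k$, the sum over all partitions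 $\tau$ of $\{0,\dots,n-1\}$ into nonempty blocks $\tau_1,\dots,\tau_k$ (of any number $k$), where $i_j=|\tau_j|$ and $p_j=\langle(\pi_b)_{b\in\tau_j},\pi_n\rangle:A^n\times X\to A^{i_j}\times X$. - Restriction: $\overline{(f_*,f_1,f_2,\dots)}=(\overline{f_*},\overline{\pi_1f_*}\,\pi_0,\overline{\pi_2f_*}\,0,\overline{\pi_3f_*}\,0,\dots)$. - Terminal object: $((1,!,1_1),1)$, with maps $(!,!,!,\dots)$. - Products: $((A,+_A,0_A),X)\times((B,+_B,0_B),Y)=((A\times B,\mathrm{ex}(+_A\times+_B),\langle0_A,0_B\rangle),X\times Y)$, where $\mathrm{ex}$ interchanges the two interior factors of $(A\times B)\times(A\times B)$; projections $(\pi_i,\pi_0\pi_i,0,0,\dots)$ for $i=0,1$; and pairing $\langle f,g\rangle_*=\langle f_*,g_*\rangle$, $\langle f,g\rangle_n=\langle f_n,g_n\rangle$ for $n\ge1$. -/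

import Mathlib

open CategoryTheory

universe v u

namespace CartRes

/-! ### Restriction categories

Composition is written in diagrammatic order throughout: `f ≫ g` is "first `f`, then `g`". -/

/-- A restriction combinator: every `f : X ⟶ Y` has a restriction `rs f : X ⟶ X`. -/
class Restriction (C : Type u) [Category.{v} C] where
  rs : ∀ {X Y : C}, (X ⟶ Y) → (X ⟶ X)

open Restriction

/-- The four axioms [R.1]-[R.4] of a restriction category. -/
class RestrictionCategory (C : Type u) [Category.{v} C] [Restriction C] : Prop where
  rs_comp_self : ∀ {X Y : C} (f : X ⟶ Y), rs f ≫ f = f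
  rs_comm : ∀ {X Y Z : C} (f : X ⟶ Y) (g : X ⟶ Z), rs f ≫ rs g = rs g ≫ rs f
  rs_rs_comp : ∀ {X Y Z : C} (f : X ⟶ Y) (g : X ⟶ Z), rs (rs f ≫ g) = rs f ≫ rs g
  comp_rs : ∀ {X Y Z : C} (f : X ⟶ Y) (g : Y ⟶ Z), f ≫ rs g = rs (f ≫ g) ≫ f

/-- A map is total when its restriction is the identity. -/
def IsTotal {C : Type u} [Category.{v} C] [Restriction C] {X Y : C} (f : X ⟶ Y) : Prop :=
  rs f = 𝟙 X

/-- The restriction order: `f ≤ g` when `f` is a restriction of `g`. -/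
def ResLE {C : Type u} [Category.{v} C] [Restriction C] {X Y : C} (f g : X ⟶ Y) : Prop :=
  rs f ≫ g = f

/-! ### Cartesian restriction categories -/

/-- The operations of chosen (restriction) finite products. -/
class CartesianStructure (C : Type u) [Category.{v} C] where
  one : C
  bang : ∀ X : C, X ⟶ one
  prod : C → C → C
  fst : ∀ X Y : C, prod X Y ⟶ X
  snd : ∀ X Y : C, prod X Y ⟶ Y
  pair : ∀ {Z X Y : C}, (Z ⟶ X) → (Z ⟶ Y) → (Z ⟶ prod X Y)

open CartesianStructure

/-- A Cartesian restriction category: a restriction category with a chosen restriction terminal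
object and chosen binary restriction products. -/
class CartesianRestrictionCategory (C : Type u) [Category.{v} C] [Restriction C]
    [CartesianStructure C] : Prop extends RestrictionCategory C where
  bang_total : ∀ X : C, IsTotal (bang X)
  bang_unique : ∀ {X : C} (f : X ⟶ one), IsTotal f → f = bang X
  comp_bang : ∀ {X Y : C} (f : X ⟶ Y), f ≫ bang Y = rs f ≫ bang X
  fst_total : ∀ X Y : C, IsTotal (fst X Y)
  snd_total : ∀ X Y : C, IsTotal (snd X Y)
  pair_fst_le : ∀ {Z X Y : C} (f : Z ⟶ X) (g : Z ⟶ Y), ResLE (pair f g ≫ fst X Y) f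
  pair_snd_le : ∀ {Z X Y : C} (f : Z ⟶ X) (g : Z ⟶ Y), ResLE (pair f g ≫ snd X Y) g
  rs_pair : ∀ {Z X Y : C} (f : Z ⟶ X) (g : Z ⟶ Y), rs (pair f g) = rs f ≫ rs g
  pair_unique : ∀ {Z X Y : C} (f : Z ⟶ X) (g : Z ⟶ Y) (h : Z ⟶ prod X Y),
    ResLE (h ≫ fst X Y) f → ResLE (h ≫ snd X Y) g → rs h = rs f ≫ rs g → h = pair f g

section basic

variable {C : Type u} [Category.{v} C] [Restriction C] [RestrictionCategory C]

open RestrictionCategory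

lemma rs_id (X : C) : rs (𝟙 X) = 𝟙 X := by
  simpa using rs_comp_self (𝟙 X)

lemma rs_rs {X Y : C} (f : X ⟶ Y) : rs (rs f) = rs f := by
  have h := rs_rs_comp f (𝟙 X)
  simpa [rs_id] using h

lemma rs_idem {X Y : C} (f : X ⟶ Y) : rs f ≫ rs f = rs f := by
  rw [← rs_rs_comp f f, rs_comp_self]

lemma rs_comp_rs {X Y Z : C} (f : X ⟶ Y) (g : Y ⟶ Z) : rs (f ≫ rs g) = rs (f ≫ g) := by
  rw [comp_rs, rs_rs_comp, rs_comm, ← rs_rs_comp, ← Category.assoc, rs_comp_self]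

lemma rs_comp_total {X Y Z : C} (f : X ⟶ Y) {g : Y ⟶ Z} (hg : IsTotal g) :
    rs (f ≫ g) = rs f := by
  rw [← rs_comp_rs, show rs g = 𝟙 Y from hg, Category.comp_id]

lemma total_comp {X Y Z : C} {f : X ⟶ Y} {g : Y ⟶ Z} (hf : IsTotal f) (hg : IsTotal g) :
    IsTotal (f ≫ g) := by
  rw [IsTotal, rs_comp_total f hg]; exact hf

lemma rs_comp_le {X Y Z : C} (f : X ⟶ Y) (g : Y ⟶ Z) : rs (f ≫ g) ≫ rs f = rs (f ≫ g) := by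
  rw [rs_comm, ← rs_rs_comp, ← Category.assoc, rs_comp_self]

end basic

section cartesian

variable {C : Type u} [Category.{v} C] [Restriction C] [CartesianStructure C]
  [CartesianRestrictionCategory C]

open RestrictionCategory CartesianRestrictionCategory

lemma pair_fst {Z X Y : C} (f : Z ⟶ X) (g : Z ⟶ Y) : pair f g ≫ fst X Y = rs g ≫ f := by
  have h := pair_fst_le f g
  rw [ResLE, rs_comp_total _ (fst_total X Y), rs_pair, rs_comm, Category.assoc,
    rs_comp_self] at h
  exact h.symm

lemma pair_snd {Z X Y : C} (f : Z ⟶ X) (g : Z ⟶ Y) : pair f g ≫ snd X Y = rs f ≫ g := by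
  have h := pair_snd_le f g
  rw [ResLE, rs_comp_total _ (snd_total X Y), rs_pair, Category.assoc, rs_comp_self] at h
  exact h.symm

lemma prod_ext {Z X Y : C} {h k : Z ⟶ prod X Y} (h₁ : h ≫ fst X Y = k ≫ fst X Y)
    (h₂ : h ≫ snd X Y = k ≫ snd X Y) : h = k := by
  have key : ∀ l : Z ⟶ prod X Y, l = pair (l ≫ fst X Y) (l ≫ snd X Y) := fun l =>
    pair_unique _ _ _ (rs_comp_self _) (rs_comp_self _) (by
      rw [rs_comp_total _ (fst_total X Y), rs_comp_total _ (snd_total X Y), rs_idem])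
  rw [key h, key k, h₁, h₂]

lemma comp_pair {W Z X Y : C} (h : W ⟶ Z) (f : Z ⟶ X) (g : Z ⟶ Y) :
    h ≫ pair f g = pair (h ≫ f) (h ≫ g) := by
  apply prod_ext
  · rw [pair_fst, Category.assoc, pair_fst, ← Category.assoc, comp_rs, Category.assoc]
  · rw [pair_snd, Category.assoc, pair_snd, ← Category.assoc, comp_rs, Category.assoc]

lemma pair_fst_snd (X Y : C) : pair (fst X Y) (snd X Y) = 𝟙 (prod X Y) := by
  apply prod_ext
  · rw [pair_fst, show rs (snd X Y) = 𝟙 _ from snd_total X Y]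
  · rw [pair_snd, show rs (fst X Y) = 𝟙 _ from fst_total X Y]

lemma pair_rs_left {Z X Y W : C} (e : Z ⟶ W) (f : Z ⟶ X) (g : Z ⟶ Y) :
    pair (rs e ≫ f) g = rs e ≫ pair f g := by
  apply prod_ext
  · rw [pair_fst, Category.assoc, pair_fst, ← Category.assoc, rs_comm, Category.assoc]
  · rw [pair_snd, Category.assoc, pair_snd, rs_rs_comp, Category.assoc]

lemma pair_rs_right {Z X Y W : C} (e : Z ⟶ W) (f : Z ⟶ X) (g : Z ⟶ Y) :
    pair f (rs e ≫ g) = rs e ≫ pair f g := by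
  apply prod_ext
  · rw [pair_fst, Category.assoc, pair_fst, rs_rs_comp, Category.assoc]
  · rw [pair_snd, Category.assoc, pair_snd, ← Category.assoc, rs_comm, Category.assoc]

lemma pair_absorb {Z X Y V W : C} (f : Z ⟶ X) (g : Z ⟶ Y) (e : Z ⟶ V) (d : Z ⟶ W)
    (he : rs e = rs g) (hd : rs d = rs f) : pair (rs e ≫ f) (rs d ≫ g) = pair f g := by
  rw [pair_rs_left, pair_rs_right, he, hd, ← Category.assoc, ← rs_pair, rs_pair, rs_comm,
    ← rs_pair, rs_comp_self]

lemma eq_rs_bang {Z : C} (k : Z ⟶ (one : C)) : k = rs k ≫ bang Z := by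
  have h := comp_bang k
  rwa [← bang_unique (𝟙 (one : C)) (rs_id _), Category.comp_id] at h

end cartesian

/-! ### Total commutative monoids -/

/-- A commutative monoid object all of whose structure maps are total. -/
structure TotalCMon (C : Type u) [Category.{v} C] [Restriction C] [CartesianStructure C] where
  carrier : C
  add : prod carrier carrier ⟶ carrier
  zero : (one : C) ⟶ carrier
  add_total : IsTotal add
  zero_total : IsTotal zero
  zero_add : pair (bang carrier ≫ zero) (𝟙 carrier) ≫ add = 𝟙 carrier
  add_comm : pair (snd carrier carrier) (fst carrier carrier) ≫ add = add
  add_assoc :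
    pair (fst (prod carrier carrier) carrier ≫ add) (snd (prod carrier carrier) carrier) ≫ add =
      pair (fst (prod carrier carrier) carrier ≫ fst carrier carrier)
        (pair (fst (prod carrier carrier) carrier ≫ snd carrier carrier)
          (snd (prod carrier carrier) carrier) ≫ add) ≫ add

namespace TotalCMon

variable {C : Type u} [Category.{v} C] [Restriction C] [CartesianStructure C]

/-- The sum `f + g` of two parallel maps into a commutative monoid. -/
def homAdd (M : TotalCMon C) {Z : C} (f g : Z ⟶ M.carrier) : Z ⟶ M.carrier :=
  pair f g ≫ M.add

/-- The zero map `Z ⟶ M`. -/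
def homZero (M : TotalCMon C) (Z : C) : Z ⟶ M.carrier :=
  bang Z ≫ M.zero

variable [CartesianRestrictionCategory C]

open RestrictionCategory CartesianRestrictionCategory

lemma comp_homAdd (M : TotalCMon C) {W Z : C} (h : W ⟶ Z) (f g : Z ⟶ M.carrier) :
    h ≫ M.homAdd f g = M.homAdd (h ≫ f) (h ≫ g) := by
  rw [homAdd, homAdd, ← Category.assoc, comp_pair]

lemma rs_homAdd (M : TotalCMon C) {Z : C} (f g : Z ⟶ M.carrier) :
    rs (M.homAdd f g) = rs f ≫ rs g := by
  rw [homAdd, rs_comp_total _ M.add_total, rs_pair]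

lemma homAdd_comm (M : TotalCMon C) {Z : C} (f g : Z ⟶ M.carrier) :
    M.homAdd f g = M.homAdd g f := by
  rw [homAdd, homAdd]
  conv_lhs => rw [← M.add_comm]
  rw [← Category.assoc, comp_pair, pair_fst, pair_snd, pair_absorb _ _ _ _ rfl rfl]

lemma homZero_add (M : TotalCMon C) {Z : C} (f : Z ⟶ M.carrier) :
    M.homAdd (M.homZero Z) f = f := by
  have h := congrArg (fun t => f ≫ t) M.zero_add
  beta_reduce at h
  rw [← Category.assoc, comp_pair, ← Category.assoc, comp_bang, Category.comp_id,
    Category.assoc, pair_rs_left] at h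
  have h' : rs f ≫ pair (bang Z ≫ M.zero) f = pair (bang Z ≫ M.zero) f := by
    rw [← pair_rs_right, rs_comp_self]
  rw [h'] at h
  exact h

lemma homAdd_assoc (M : TotalCMon C) {Z : C} (f g h : Z ⟶ M.carrier) :
    M.homAdd (M.homAdd f g) h = M.homAdd f (M.homAdd g h) := by
  have key := congrArg (fun t => pair (pair f g) h ≫ t) M.add_assoc
  beta_reduce at key
  have l₁ : pair (pair f g) h ≫ pair (fst _ _ ≫ M.add) (snd _ _) =
      pair (rs h ≫ pair f g ≫ M.add) (rs (pair f g) ≫ h) := by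
    rw [comp_pair, ← Category.assoc, pair_fst, pair_snd, Category.assoc]
  have l₂ : pair (pair f g) h ≫ pair (fst _ _ ≫ fst _ _)
        (pair (fst _ _ ≫ snd _ _) (snd _ _) ≫ M.add) =
      pair (rs h ≫ rs g ≫ f) (pair (rs h ≫ rs f ≫ g) (rs (pair f g) ≫ h) ≫ M.add) := by
    have l₃ : pair (pair f g) h ≫ pair (fst _ _ ≫ snd _ _) (snd _ _) =
        pair (rs h ≫ rs f ≫ g) (rs (pair f g) ≫ h) := by
      rw [comp_pair, ← Category.assoc, pair_fst, pair_snd, Category.assoc, pair_snd]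
    rw [comp_pair, ← Category.assoc, pair_fst, Category.assoc, pair_fst,
      ← Category.assoc (pair (pair f g) h), l₃]
  rw [← Category.assoc (pair (pair f g) h), l₁, ← Category.assoc (pair (pair f g) h), l₂] at key
  have e₁ : pair (rs h ≫ pair f g ≫ M.add) (rs (pair f g) ≫ h) = pair (pair f g ≫ M.add) h :=
    pair_absorb _ _ _ _ rfl (rs_comp_total _ M.add_total).symm
  have e₂ : pair (rs h ≫ rs f ≫ g) (rs (pair f g) ≫ h) = rs f ≫ pair g h := by
    rw [rs_pair, Category.assoc, ← Category.assoc, rs_comm, Category.assoc, pair_rs_left,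
      pair_rs_right, pair_absorb _ _ _ _ rfl rfl, ← Category.assoc, rs_idem]
  rw [e₁, e₂] at key
  have e₃ : pair (rs h ≫ rs g ≫ f) (rs f ≫ pair g h ≫ M.add) = pair f (pair g h ≫ M.add) := by
    rw [← Category.assoc, rs_comm, ← rs_pair]
    exact pair_absorb _ _ _ _ (rs_comp_total _ M.add_total).symm rfl
  rw [Category.assoc, e₃] at key
  exact key

/-- The maps `Z ⟶ M` form a commutative monoid under pointwise addition. -/
@[reducible] def homAddCommMonoid (M : TotalCMon C) (Z : C) : AddCommMonoid (Z ⟶ M.carrier) where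
  add f g := M.homAdd f g
  zero := M.homZero Z
  add_assoc f g h := M.homAdd_assoc f g h
  zero_add f := M.homZero_add f
  add_zero f := (M.homAdd_comm f _).trans (M.homZero_add f)
  add_comm f g := M.homAdd_comm f g
  nsmul := @nsmulRec (Z ⟶ M.carrier) ⟨M.homZero Z⟩ ⟨M.homAdd⟩

/-- A finite sum of parallel maps into a commutative monoid. -/
noncomputable def homSum (M : TotalCMon C) {Z : C} {ι : Type*} [Fintype ι]
    (f : ι → (Z ⟶ M.carrier)) : Z ⟶ M.carrier :=
  letI := M.homAddCommMonoid Z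
  ∑ i, f i

end TotalCMon

section products

variable {C : Type u} [Category.{v} C] [Restriction C] [CartesianStructure C]

/-- The product map `f × g`. -/
def prodMap {X X' Y Y' : C} (f : X ⟶ X') (g : Y ⟶ Y') : prod X Y ⟶ prod X' Y' :=
  pair (fst X Y ≫ f) (snd X Y ≫ g)

/-- The map `(A × B) × (A × B) ⟶ (A × A) × (B × B)` interchanging the two interior terms. -/
def ex (A B : C) : prod (prod A B) (prod A B) ⟶ prod (prod A A) (prod B B) :=
  pair (pair (fst _ _ ≫ fst A B) (snd _ _ ≫ fst A B))
    (pair (fst _ _ ≫ snd A B) (snd _ _ ≫ snd A B))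

variable [CartesianRestrictionCategory C]

open RestrictionCategory CartesianRestrictionCategory TotalCMon

lemma pair_ex_map (M N : TotalCMon C) {Z : C} (p q : Z ⟶ prod M.carrier N.carrier) :
    pair p q ≫ ex M.carrier N.carrier ≫ prodMap M.add N.add =
      pair (M.homAdd (p ≫ fst _ _) (q ≫ fst _ _)) (N.homAdd (p ≫ snd _ _) (q ≫ snd _ _)) := by
  have e₁ : pair p q ≫ ex M.carrier N.carrier =
      pair (pair (p ≫ fst _ _) (q ≫ fst _ _)) (pair (p ≫ snd _ _) (q ≫ snd _ _)) := by
    rw [ex, comp_pair, comp_pair, comp_pair]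
    simp only [← Category.assoc, pair_fst, pair_snd]
    simp only [Category.assoc]
    rw [pair_absorb _ _ _ _ (rs_comp_total q (fst_total _ _)).symm
        (rs_comp_total p (fst_total _ _)).symm,
      pair_absorb _ _ _ _ (rs_comp_total q (snd_total _ _)).symm
        (rs_comp_total p (snd_total _ _)).symm]
  rw [← Category.assoc, e₁, prodMap, comp_pair, ← Category.assoc, ← Category.assoc, pair_fst,
    pair_snd, Category.assoc, Category.assoc]
  refine pair_absorb _ _ _ _ ?_ ?_
  · exact (rs_comp_total _ N.add_total).symm
  · exact (rs_comp_total _ M.add_total).symm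

lemma pair_total {Z X Y : C} {f : Z ⟶ X} {g : Z ⟶ Y} (hf : IsTotal f) (hg : IsTotal g) :
    IsTotal (pair f g) := by
  rw [IsTotal, rs_pair, show rs f = 𝟙 _ from hf, show rs g = 𝟙 _ from hg, Category.comp_id]

lemma pair_fst_of_total {Z X Y : C} (f : Z ⟶ X) {g : Z ⟶ Y} (hg : IsTotal g) :
    pair f g ≫ fst X Y = f := by
  rw [pair_fst, show rs g = 𝟙 _ from hg, Category.id_comp]

lemma pair_snd_of_total {Z X Y : C} {f : Z ⟶ X} (g : Z ⟶ Y) (hf : IsTotal f) :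
    pair f g ≫ snd X Y = g := by
  rw [pair_snd, show rs f = 𝟙 _ from hf, Category.id_comp]

lemma ex_map_eq (M N : TotalCMon C) : ex M.carrier N.carrier ≫ prodMap M.add N.add =
      pair (M.homAdd (fst _ _ ≫ fst _ _) (snd _ _ ≫ fst _ _))
        (N.homAdd (fst _ _ ≫ snd _ _) (snd _ _ ≫ snd _ _)) := by
  rw [← pair_ex_map, pair_fst_snd, Category.id_comp]

lemma ex_map_total (M N : TotalCMon C) :
    IsTotal (ex M.carrier N.carrier ≫ prodMap M.add N.add) := by
  rw [ex_map_eq]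
  refine pair_total ?_ ?_
  · exact total_comp (pair_total (total_comp (fst_total _ _) (fst_total _ _))
      (total_comp (snd_total _ _) (fst_total _ _))) M.add_total
  · exact total_comp (pair_total (total_comp (fst_total _ _) (snd_total _ _))
      (total_comp (snd_total _ _) (snd_total _ _))) N.add_total

lemma ex_map_fst (M N : TotalCMon C) : ex M.carrier N.carrier ≫ prodMap M.add N.add ≫ fst _ _ =
    M.homAdd (fst _ _ ≫ fst _ _) (snd _ _ ≫ fst _ _) := by
  rw [← Category.assoc, ex_map_eq, pair_fst_of_total]
  exact total_comp (pair_total (total_comp (fst_total _ _) (snd_total _ _))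
      (total_comp (snd_total _ _) (snd_total _ _))) N.add_total

lemma ex_map_snd (M N : TotalCMon C) : ex M.carrier N.carrier ≫ prodMap M.add N.add ≫ snd _ _ =
    N.homAdd (fst _ _ ≫ snd _ _) (snd _ _ ≫ snd _ _) := by
  rw [← Category.assoc, ex_map_eq, pair_snd_of_total]
  exact total_comp (pair_total (total_comp (fst_total _ _) (fst_total _ _))
      (total_comp (snd_total _ _) (fst_total _ _))) M.add_total

/-- The product `(A × B, ex ≫ (+_A × +_B), ⟨0_A, 0_B⟩)` of two total commutative monoids. -/
def TotalCMon.prod (M N : TotalCMon C) : TotalCMon C where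
  carrier := CartesianStructure.prod M.carrier N.carrier
  add := ex M.carrier N.carrier ≫ prodMap M.add N.add
  zero := pair M.zero N.zero
  add_total := ex_map_total M N
  zero_total := pair_total M.zero_total N.zero_total
  zero_add := by
    rw [pair_ex_map]
    simp only [Category.assoc, pair_fst_of_total _ N.zero_total,
      pair_snd_of_total _ M.zero_total, Category.id_comp]
    have h₁ : bang (CartesianStructure.prod M.carrier N.carrier) ≫ M.zero = M.homZero _ := rfl
    have h₂ : bang (CartesianStructure.prod M.carrier N.carrier) ≫ N.zero = N.homZero _ := rfl
    rw [h₁, h₂, homZero_add, homZero_add, pair_fst_snd]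
  add_comm := by
    rw [pair_ex_map, M.homAdd_comm, N.homAdd_comm, ← ex_map_eq]
  add_assoc := by
    rw [pair_ex_map, pair_ex_map, pair_ex_map]
    simp only [Category.assoc, ex_map_fst, ex_map_snd, comp_homAdd]
    rw [pair_fst_of_total, pair_snd_of_total, homAdd_assoc, homAdd_assoc]
    all_goals
      simp only [IsTotal, rs_homAdd, ← Category.assoc,
        rs_comp_total _ (fst_total _ _), rs_comp_total _ (snd_total _ _),
        show ∀ X Y : C, rs (fst X Y) = 𝟙 _ from fst_total,
        show ∀ X Y : C, rs (snd X Y) = 𝟙 _ from snd_total, Category.comp_id]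

/-- The terminal commutative monoid `(1, !, 1)`. -/
def TotalCMon.unit (C : Type u) [Category.{v} C] [Restriction C] [CartesianStructure C]
    [CartesianRestrictionCategory C] : TotalCMon C where
  carrier := one
  add := bang _
  zero := 𝟙 _
  add_total := bang_total _
  zero_total := rs_id _
  zero_add := by
    rw [bang_unique (𝟙 (one : C)) (rs_id _)]
    exact bang_unique _ (total_comp (pair_total (total_comp (bang_total _) (bang_total _))
      (bang_total _)) (bang_total _))
  add_comm := bang_unique _ (total_comp (pair_total (snd_total _ _) (fst_total _ _)) (bang_total _))
  add_assoc := by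
    rw [bang_unique (pair _ _ ≫ bang _), bang_unique (pair _ _ ≫ bang _)]
    · exact total_comp (pair_total (total_comp (fst_total _ _) (fst_total _ _))
        (total_comp (pair_total (total_comp (fst_total _ _) (snd_total _ _)) (snd_total _ _))
          (bang_total _))) (bang_total _)
    · exact total_comp (pair_total (total_comp (fst_total _ _) (bang_total _)) (snd_total _ _))
        (bang_total _)

end products

/-! ### Iterated products `A × (A × ⋯ × (A × X))` -/

section powers

variable {C : Type u} [Category.{v} C] [CartesianStructure C]

/-- `pow A X n` is `A × ⋯ × A × X` with `n` factors `A` (bracketed to the right). -/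
def pow (A X : C) : ℕ → C
  | 0 => X
  | n + 1 => prod A (pow A X n)

/-- The tuple `⟨a_0, …, a_{n-1}, x⟩ : Z ⟶ A × ⋯ × A × X`. -/
def tuple {A X Z : C} : ∀ {n : ℕ}, (Fin n → (Z ⟶ A)) → (Z ⟶ X) → (Z ⟶ pow A X n)
  | 0, _, x => x
  | _ + 1, a, x => pair (a 0) (tuple (fun i => a i.succ) x)

/-- The projection `π_i : A × ⋯ × A × X ⟶ A`, for `i < n`. -/
def proj (A X : C) : ∀ {n : ℕ}, Fin n → (pow A X n ⟶ A)
  | n + 1, i => Fin.cases (fst A (pow A X n)) (fun j => snd A (pow A X n) ≫ proj A X j) i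

/-- The last projection `π_n : A × ⋯ × A × X ⟶ X`. -/
def projLast (A X : C) : ∀ n : ℕ, pow A X n ⟶ X
  | 0 => 𝟙 X
  | n + 1 => snd A (pow A X n) ≫ projLast A X n

end powers

/-! ### Objects and maps of the Faà di Bruno category -/

/-- An object: a pair of a total commutative monoid `(A,+,0)` and an object `X`. -/
structure FaaObj (C : Type u) [Category.{v} C] [Restriction C] [CartesianStructure C] where
  vec : TotalCMon C
  pt : C

section faa

variable {C : Type u} [Category.{v} C] [Restriction C] [CartesianStructure C]

/-- The source `A^n × X` of the `n`-th component of a map out of `((A,+,0),X)`. -/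
def FaaObj.src (P : FaaObj C) (n : ℕ) : C := pow P.vec.carrier P.pt n

/-- A map `f : A^n × X ⟶ B` is symmetric in its first `n` variables. -/
def IsSymmetric {A X B : C} {n : ℕ} (f : pow A X n ⟶ B) : Prop :=
  ∀ (σ : Equiv.Perm (Fin n)) {Z : C} (a : Fin n → (Z ⟶ A)) (x : Z ⟶ X),
    tuple (fun i => a (σ i)) x ≫ f = tuple a x ≫ f

/-- A map `f : A^n × X ⟶ B` is additive in each of its first `n` variables: substituting a sum
in such a variable gives the sum, and substituting zero gives a restriction of zero. -/
def IsAdditive (A B : TotalCMon C) {X : C} {n : ℕ} (f : pow A.carrier X n ⟶ B.carrier) : Prop :=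
  (∀ {Z : C} (a : Fin n → (Z ⟶ A.carrier)) (x : Z ⟶ X) (i : Fin n) (b : Z ⟶ A.carrier),
    tuple (Function.update a i (A.homAdd (a i) b)) x ≫ f =
      B.homAdd (tuple a x ≫ f) (tuple (Function.update a i b) x ≫ f)) ∧
  (∀ {Z : C} (a : Fin n → (Z ⟶ A.carrier)) (x : Z ⟶ X) (i : Fin n),
    tuple (Function.update a i (A.homZero Z)) x ≫ f =
      rs (tuple (Function.update a i (A.homZero Z)) x ≫ f) ≫ B.homZero Z)

/-- A map `((A,+,0),X) ⟶ ((B,+,0),Y)`: a sequence `(f_*, f_1, f_2, …)` with `f_* : X ⟶ Y` and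
`f_n : A^n × X ⟶ B` (for `n ≥ 1`) additive and symmetric in the first `n` variables, whose
restriction is that of `π_n ≫ f_*`. -/
@[ext]
structure FaaHom (P Q : FaaObj C) where
  star : P.pt ⟶ Q.pt
  term : ∀ n : ℕ, 0 < n → (P.src n ⟶ Q.vec.carrier)
  rs_term : ∀ (n : ℕ) (hn : 0 < n),
    rs (term n hn) = rs (projLast P.vec.carrier P.pt n ≫ star)
  symmetric : ∀ (n : ℕ) (hn : 0 < n), IsSymmetric (term n hn)
  additive : ∀ (n : ℕ) (hn : 0 < n), IsAdditive P.vec Q.vec (term n hn)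

/-- The summand of the `n`-th component of a composite which corresponds to a partition `τ` of
`{0, …, n-1}` into `k` blocks, that is, to a (symmetric) tree of height two and width `n` whose
root has `k` branches:
`⟨p_1 ≫ f_{i_1}, …, p_k ≫ f_{i_k}, π_n ≫ f_*⟩ ≫ g_k`, where the `j`-th block has `i_j` elements
and `p_j = ⟨π_b (b in the j-th block), π_n⟩`. -/
def compSummand {P Q R : FaaObj C} (f : FaaHom P Q) (g : FaaHom Q R) {n : ℕ} (hn : 0 < n)
    (τ : OrderedFinpartition n) : P.src n ⟶ R.vec.carrier :=
  tuple (A := Q.vec.carrier) (X := Q.pt)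
      (fun j : Fin τ.length =>
        tuple (fun b : Fin (τ.partSize j) => proj P.vec.carrier P.pt (τ.emb j b))
            (projLast P.vec.carrier P.pt n) ≫
          f.term (τ.partSize j) (τ.partSize_pos j))
      (projLast P.vec.carrier P.pt n ≫ f.star) ≫
    g.term τ.length (τ.length_pos hn)

variable [CartesianRestrictionCategory C]

/-- The `n`-th component of a composite: the sum over all partitions of the `n` variables, that
is, over all trees of height two and width `n`. -/
noncomputable def compTerm {P Q R : FaaObj C} (f : FaaHom P Q) (g : FaaHom Q R) (n : ℕ)
    (hn : 0 < n) : P.src n ⟶ R.vec.carrier :=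
  R.vec.homSum fun τ : OrderedFinpartition n => compSummand f g hn τ

/-- The terminal object `((1,!,1),1)`. -/
def FaaObj.unit (C : Type u) [Category.{v} C] [Restriction C] [CartesianStructure C]
    [CartesianRestrictionCategory C] : FaaObj C where
  vec := TotalCMon.unit C
  pt := one

/-- The product `(A × B, X × Y)` of `(A,X)` and `(B,Y)`. -/
def FaaObj.prod (P Q : FaaObj C) : FaaObj C where
  vec := P.vec.prod Q.vec
  pt := CartesianStructure.prod P.pt Q.pt

end faa

/-! ### The operations of the Faà di Bruno category, described by their components -/

/-- Operations on the objects `FaaObj C` and maps `FaaHom`, given by the prescribed components: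
* identities `(1, π_0, 0, 0, …)`;
* composites `(f_* ≫ g_*, …)`, with `n`-th component the sum over trees;
* restrictions `(rs f_*, rs(π_1 f_*) π_0, rs(π_2 f_*) 0, rs(π_3 f_*) 0, …)`;
* the maps `(!, !, !, …)` to the terminal object;
* projections `(π_i, π_0 π_i, 0, 0, …)`;
* pairings `(⟨f_*,g_*⟩, ⟨f_1,g_1⟩, ⟨f_2,g_2⟩, …)`.
Such operations, if they exist, are unique; that they exist means that the displayed sequences
are maps, i.e. are additive, symmetric, and have the required restrictions. -/
structure FaaOperations (C : Type u) [Category.{v} C] [Restriction C] [CartesianStructure C]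
    [CartesianRestrictionCategory C] where
  id : ∀ P : FaaObj C, FaaHom P P
  id_star : ∀ P, (id P).star = 𝟙 P.pt
  id_term : ∀ (P) (n : ℕ) (hn : 0 < n), (id P).term n hn =
    if n = 1 then proj P.vec.carrier P.pt ⟨0, hn⟩ else P.vec.homZero (P.src n)
  comp : ∀ {P Q R : FaaObj C}, FaaHom P Q → FaaHom Q R → FaaHom P R
  comp_star : ∀ {P Q R : FaaObj C} (f : FaaHom P Q) (g : FaaHom Q R),
    (comp f g).star = f.star ≫ g.star
  comp_term : ∀ {P Q R : FaaObj C} (f : FaaHom P Q) (g : FaaHom Q R) (n : ℕ) (hn : 0 < n),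
    (comp f g).term n hn = compTerm f g n hn
  res : ∀ {P Q : FaaObj C}, FaaHom P Q → FaaHom P P
  res_star : ∀ {P Q : FaaObj C} (f : FaaHom P Q), (res f).star = rs f.star
  res_term : ∀ {P Q : FaaObj C} (f : FaaHom P Q) (n : ℕ) (hn : 0 < n), (res f).term n hn =
    rs (projLast P.vec.carrier P.pt n ≫ f.star) ≫
      if n = 1 then proj P.vec.carrier P.pt ⟨0, hn⟩ else P.vec.homZero (P.src n)
  bang : ∀ P : FaaObj C, FaaHom P (FaaObj.unit C)
  bang_star : ∀ P, (bang P).star = CartesianStructure.bang P.pt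
  bang_term : ∀ (P) (n : ℕ) (hn : 0 < n),
    (bang P).term n hn = CartesianStructure.bang (P.src n)
  fst : ∀ P Q : FaaObj C, FaaHom (P.prod Q) P
  fst_star : ∀ P Q, (fst P Q).star = CartesianStructure.fst P.pt Q.pt
  fst_term : ∀ (P Q) (n : ℕ) (hn : 0 < n), (fst P Q).term n hn =
    if n = 1 then
      proj (P.prod Q).vec.carrier (P.prod Q).pt ⟨0, hn⟩ ≫
        CartesianStructure.fst P.vec.carrier Q.vec.carrier
    else P.vec.homZero ((P.prod Q).src n)
  snd : ∀ P Q : FaaObj C, FaaHom (P.prod Q) Q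
  snd_star : ∀ P Q, (snd P Q).star = CartesianStructure.snd P.pt Q.pt
  snd_term : ∀ (P Q) (n : ℕ) (hn : 0 < n), (snd P Q).term n hn =
    if n = 1 then
      proj (P.prod Q).vec.carrier (P.prod Q).pt ⟨0, hn⟩ ≫
        CartesianStructure.snd P.vec.carrier Q.vec.carrier
    else Q.vec.homZero ((P.prod Q).src n)
  pair : ∀ {S P Q : FaaObj C}, FaaHom S P → FaaHom S Q → FaaHom S (P.prod Q)
  pair_star : ∀ {S P Q : FaaObj C} (f : FaaHom S P) (g : FaaHom S Q),
    (pair f g).star = CartesianStructure.pair f.star g.star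
  pair_term : ∀ {S P Q : FaaObj C} (f : FaaHom S P) (g : FaaHom S Q) (n : ℕ) (hn : 0 < n),
    (pair f g).term n hn = CartesianStructure.pair (f.term n hn) (g.term n hn)

namespace FaaOperations

variable {C : Type u} [Category.{v} C] [Restriction C] [CartesianStructure C]
  [CartesianRestrictionCategory C]

/-- The category laws for the identities and composition. -/
structure IsCategory (S : FaaOperations C) : Prop where
  id_comp : ∀ {P Q : FaaObj C} (f : FaaHom P Q), S.comp (S.id P) f = f
  comp_id : ∀ {P Q : FaaObj C} (f : FaaHom P Q), S.comp f (S.id Q) = f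
  assoc : ∀ {P Q R T : FaaObj C} (f : FaaHom P Q) (g : FaaHom Q R) (h : FaaHom R T),
    S.comp (S.comp f g) h = S.comp f (S.comp g h)

/-- The category of objects `FaaObj C` and maps `FaaHom`. -/
@[reducible] def category (S : FaaOperations C) (h : S.IsCategory) :
    Category.{v} (FaaObj C) where
  Hom := FaaHom
  id := S.id
  comp := S.comp
  id_comp := h.id_comp
  comp_id := h.comp_id
  assoc := h.assoc

/-- The restriction combinator on `S.category h`. -/
@[reducible] def restriction (S : FaaOperations C) (h : S.IsCategory) :
    @Restriction (FaaObj C) (S.category h) :=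
  letI := S.category h
  { rs := S.res }

/-- The chosen finite products on `S.category h`. -/
@[reducible] def cartesian (S : FaaOperations C) (h : S.IsCategory) :
    @CartesianStructure (FaaObj C) (S.category h) :=
  letI := S.category h
  { one := FaaObj.unit C
    bang := S.bang
    prod := FaaObj.prod
    fst := S.fst
    snd := S.snd
    pair := S.pair }

end FaaOperations

end CartRes

open CartRes

/-! The proof evaluates everything at points, which turns partial maps into ordinary algebra. Fix `e
: Z ⟶ W`, of which only the domain of definition matters. The maps `Z ⟶ M` with the domain of `e`
form an ordinary commutative monoid `Germ M e`, with zero the restriction of `0`. At a point `x`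
such that `x` and `x ≫ f.star` have this domain, a Faà di Bruno map `f` becomes a sequence of
symmetric `ℕ`-multilinear maps between such monoids, its `series`. Nothing is lost: by `eq_of_germ`
a component is determined by its values on germs, because the restricted projections form a generic
family. Conversely, `isSymmetric_of_germ` and `isAdditive_of_germ` lift symmetry and additivity from
germs to families with arbitrary domains.

By `tuple_compTerm`, composition of maps is Faà di Bruno composition of series. For ordinary monoids
this is associative because both bracketings are sums over chains `π ≤ ρ` of equivalence relations
on the index set (`SymSeries.comp_assoc`). Composing with a series that has only a linear term
leaves a single summand, which handles identities, restrictions and projections. A restriction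
depends only on the domain of `star` and just cuts down components, so the restriction axioms follow
from those of the base; products are computed componentwise. -/

/-- A sequence of symmetric multilinear maps `A^n → B` between commutative monoids. -/
@[ext]
structure SymSeries (A B : Type*) [AddCommMonoid A] [AddCommMonoid B] where
  term : ∀ n : ℕ, MultilinearMap ℕ (fun _ : Fin n => A) B
  symm : ∀ (n : ℕ) (σ : Equiv.Perm (Fin n)) (a : Fin n → A), term n (a ∘ σ) = term n a

/-! ### Ordered partitions as equivalence relations -/

namespace OrderedFinpartition

variable {n : ℕ}

lemma index_emb (c : OrderedFinpartition n) (i : Fin c.length) (b : Fin (c.partSize i)) :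
    c.index (c.emb i b) = i := by
  by_contra h
  exact c.emb_ne_emb_of_ne h (c.emb_invEmbedding _)

/-- The `i`-th part, as a fibre of the map sending an element to the index of its part. -/
noncomputable def partEquiv (c : OrderedFinpartition n) (i : Fin c.length) :
    Fin (c.partSize i) ≃ {x // c.index x = i} :=
  Equiv.ofBijective (fun b => ⟨c.emb i b, c.index_emb i b⟩) (by
    constructor
    · intro a b h
      exact (c.emb_strictMono i).injective (congrArg Subtype.val h)
    · rintro ⟨x, rfl⟩
      exact ⟨c.invEmbedding x, Subtype.ext (c.emb_invEmbedding x)⟩)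

lemma index_surjective (c : OrderedFinpartition n) : Function.Surjective c.index := fun i =>
  ⟨c.emb i ⟨0, c.partSize_pos i⟩, c.index_emb _ _⟩

/-- The equivalence relation of lying in the same part. -/
noncomputable def toSetoid (c : OrderedFinpartition n) : Setoid (Fin n) := Setoid.ker c.index

/-- The greatest element of a part. -/
def last (c : OrderedFinpartition n) (i : Fin c.length) : Fin n :=
  c.emb i ⟨c.partSize i - 1, Nat.sub_one_lt_of_lt (c.partSize_pos i)⟩

lemma le_last (c : OrderedFinpartition n) {x : Fin n} {i : Fin c.length} (h : c.index x = i) :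
    x ≤ c.last i := by
  subst h
  conv_lhs => rw [← c.emb_invEmbedding x]
  apply (c.emb_strictMono _).monotone
  rw [Fin.le_def]
  have := (c.invEmbedding x).2
  simp only
  omega

/-- The maxima of the parts are visible from the equivalence relation alone; together with
`range_emb` this recovers the whole ordered partition. -/
lemma range_last (c : OrderedFinpartition n) :
    Set.range c.last = {x | ∀ y, c.toSetoid y x → y ≤ x} := by
  ext x
  constructor
  · rintro ⟨i, rfl⟩ y hy
    exact c.le_last ((show c.index y = _ from hy).trans (c.index_emb _ _))
  · intro h
    exact ⟨c.index x, le_antisymm (h _ (c.index_emb _ _)) (c.le_last rfl)⟩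

lemma range_emb (c : OrderedFinpartition n) (i : Fin c.length) :
    Set.range (c.emb i) = {x | c.toSetoid x (c.last i)} := by
  have hl : c.index (c.last i) = i := c.index_emb _ _
  ext x
  constructor
  · rintro ⟨b, rfl⟩
    exact (c.index_emb _ _).trans hl.symm
  · intro h
    obtain rfl : c.index x = i := (show c.index x = _ from h).trans hl
    exact ⟨_, c.emb_invEmbedding x⟩

/-- A strictly monotone map out of `Fin k` is the increasing enumeration of its range, so the range
fixes both `k` and the map. -/
lemma strictMono_fin_unique {k l : ℕ} {f : Fin k → Fin n} {g : Fin l → Fin n}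
    (hf : StrictMono f) (hg : StrictMono g) (h : Set.range f = Set.range g) :
    k = l ∧ HEq f g := by
  have hk : k = l := by
    have h1 := Set.card_range_of_injective hf.injective
    have h2 := Set.card_range_of_injective hg.injective
    rw [← Nat.card_eq_fintype_card] at h1 h2
    rw [h, h2] at h1
    simpa using h1.symm
  subst hk
  refine ⟨rfl, heq_of_eq ?_⟩
  exact (StrictMono.range_inj hf hg).1 h

/-- Parts are listed by increasing greatest element. The relation therefore determines the list of
maxima, and then each part as the class of its maximum. -/
lemma toSetoid_injective :
    Function.Injective (toSetoid : OrderedFinpartition n → Setoid (Fin n)) := by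
  intro c d h
  have h0 : Set.range c.last = Set.range d.last := by rw [range_last, range_last, h]
  have h1 := strictMono_fin_unique c.parts_strictMono d.parts_strictMono h0
  have h2 : ∀ (i : Fin c.length) (j : Fin d.length), (i : ℕ) = j →
      c.partSize i = d.partSize j ∧ HEq (c.emb i) (d.emb j) := by
    intro i j hij
    apply strictMono_fin_unique (c.emb_strictMono i) (d.emb_strictMono j)
    rw [range_emb, range_emb, h]
    have : c.last i = d.last j := by
      exact (Fin.heq_fun_iff h1.1).1 h1.2 i |>.trans (congrArg d.last (Fin.ext hij))
    rw [this]
  ext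
  · exact h1.1
  · rw [Fin.heq_fun_iff h1.1]
    exact fun i => (h2 i _ rfl).1
  · refine Function.hfunext (by rw [h1.1]) ?_
    intro i j hij
    exact (h2 i j ((Fin.heq_ext_iff h1.1).1 hij)).2

lemma toSetoid_surjective :
    Function.Surjective (toSetoid : OrderedFinpartition n → Setoid (Fin n)) := by
  classical
  intro s
  let cls : Fin n → Finset (Fin n) := fun x => Finset.univ.filter fun y => s y x
  have hcls : ∀ x, (cls x).Nonempty := fun x => ⟨x, by simp [cls]⟩
  -- `M` has one representative per class, its maximum; enumerating `M` increasingly gives the order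
  -- that `parts_strictMono` demands.
  let M : Finset (Fin n) := Finset.univ.filter fun x => ∀ y, s y x → y ≤ x
  let o : Fin M.card ≃o M := M.orderIsoOfFin rfl
  have hM : ∀ x, ∃ m : M, s x m := by
    intro x
    refine ⟨⟨(cls x).max' (hcls x), ?_⟩, ?_⟩
    · have h0 := (cls x).max'_mem (hcls x)
      simp only [M, Finset.mem_filter, Finset.mem_univ, true_and]
      intro y hy
      apply Finset.le_max'
      simp only [cls, Finset.mem_filter, Finset.mem_univ, true_and] at h0 ⊢
      exact s.trans hy h0
    · have h0 := (cls x).max'_mem (hcls x)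
      simp only [cls, Finset.mem_filter, Finset.mem_univ, true_and] at h0 ⊢
      exact s.symm h0
  have hMu : ∀ m m' : M, s m m' → m = m' := by
    intro m m' h
    have h1 := (Finset.mem_filter.1 m.2).2
    have h2 := (Finset.mem_filter.1 m'.2).2
    exact Subtype.ext (le_antisymm (h2 _ h) (h1 _ (s.symm h)))
  have hlast : ∀ m : M, ∀ h, (cls m).orderEmbOfFin rfl ⟨(cls m).card - 1, h⟩ = (m : Fin n) := by
    intro m h
    rw [Finset.orderEmbOfFin_last rfl (Finset.card_pos.2 (hcls m))]
    apply le_antisymm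
    · apply Finset.max'_le
      intro y hy
      exact (Finset.mem_filter.1 m.2).2 y (Finset.mem_filter.1 hy).2
    · apply Finset.le_max'
      simp [cls]
  have hr : ∀ m : Fin n, ∀ x, x ∈ Set.range ((cls m).orderEmbOfFin rfl) ↔ s x m := by
    intro m x
    rw [Finset.range_orderEmbOfFin]
    simp [cls]
  let c : OrderedFinpartition n :=
    { length := M.card
      partSize := fun i => (cls (o i)).card
      partSize_pos := fun i => Finset.card_pos.2 (hcls _)
      emb := fun i => (cls (o i)).orderEmbOfFin rfl
      emb_strictMono := fun i => OrderEmbedding.strictMono _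
      parts_strictMono := by
        intro i j hij
        simp only [hlast]
        exact o.strictMono hij
      disjoint := by
        intro i _ j _ hij
        rw [Function.onFun, Set.disjoint_left]
        intro x hx hy
        rw [hr] at hx hy
        exact hij (o.injective (hMu _ _ (s.trans (s.symm hx) hy)))
      cover := by
        intro x
        obtain ⟨m, hm⟩ := hM x
        refine ⟨o.symm m, ?_⟩
        rw [hr]
        simpa using hm }
  refine ⟨c, ?_⟩
  have key : ∀ x i, c.index x = i ↔ s x (o i) := by
    intro x i
    rw [← hr]
    constructor
    · rintro rfl
      exact ⟨_, c.emb_invEmbedding x⟩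
    · rintro ⟨b, rfl⟩
      exact c.index_emb i b
  ext x y
  change c.index x = c.index y ↔ _
  rw [key]
  have hy := (key y _).1 rfl
  exact ⟨fun h => s.trans h (s.symm hy), fun h => s.trans h hy⟩

end OrderedFinpartition

/-! ### Faà di Bruno composition over ordinary commutative monoids -/

instance Setoid.finite {ι : Type*} [Finite ι] : Finite (Setoid ι) :=
  Finite.of_injective (fun s : Setoid ι => (s : ι → ι → Prop)) fun _ _ h =>
    Setoid.ext fun a b => iff_of_eq (congrFun (congrFun h a) b)

noncomputable instance Setoid.fintype {ι : Type*} [Finite ι] : Fintype (Setoid ι) :=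
  Fintype.ofFinite _

/-- The fibre of a map over a point. -/
abbrev Fibre {ι κ : Type} (φ : ι → κ) (k : κ) : Type := {x // φ x = k}

namespace SymSeries

variable {A B D E : Type*} [AddCommMonoid A] [AddCommMonoid B] [AddCommMonoid D]
  [AddCommMonoid E]

lemma term_comp_equiv (p : SymSeries A B) {m n : ℕ} (σ : Fin m ≃ Fin n) (a : Fin n → A) :
    p.term m (a ∘ σ) = p.term n a := by
  obtain rfl : m = n := by simpa using Fintype.card_congr σ
  exact p.symm m σ a

/-- The evaluation of a symmetric series on a finite family of vectors. -/
noncomputable def ev (p : SymSeries A B) (ι : Type) [Finite ι] :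
    MultilinearMap ℕ (fun _ : ι => A) B :=
  (p.term (Nat.card ι)).domDomCongr (Finite.equivFin ι).symm

/-- Symmetry makes `ev` independent of the enumeration chosen in its definition, so quotients and
fibres can serve as index sets without an order. -/
lemma ev_comp_equiv (p : SymSeries A B) {ι κ : Type} [Finite ι] [Finite κ] (e : ι ≃ κ)
    (a : κ → A) : p.ev ι (a ∘ e) = p.ev κ a := by
  have h := p.term_comp_equiv ((Finite.equivFin ι).symm.trans (e.trans (Finite.equivFin κ)))
    (a ∘ (Finite.equivFin κ).symm)
  simp only [ev, MultilinearMap.domDomCongr_apply]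
  rw [show (fun i => a ((Finite.equivFin κ).symm i)) = a ∘ (Finite.equivFin κ).symm from rfl, ← h]
  congr 1
  ext i
  simp

lemma ev_eq_of_equiv (p : SymSeries A B) {ι κ : Type} [Finite ι] [Finite κ] (e : ι ≃ κ)
    {a : ι → A} {b : κ → A} (h : ∀ i, a i = b (e i)) : p.ev ι a = p.ev κ b := by
  rw [← p.ev_comp_equiv e]
  exact congrArg _ (funext h)

lemma ev_fin (p : SymSeries A B) {n : ℕ} (a : Fin n → A) : p.ev (Fin n) a = p.term n a :=
  p.term_comp_equiv (Finite.equivFin (Fin n)).symm a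

/-- The contribution to a composite of the partition of `ι` into the fibres of `φ`. -/
noncomputable def along (q : SymSeries B D) (p : SymSeries A B) {ι κ : Type} [Finite ι] [Finite κ]
    (φ : ι → κ) (a : ι → A) : D :=
  q.ev κ fun k => p.ev (Fibre φ k) fun x => a x

/-- Only the induced partition matters, not the names of its elements and blocks. -/
lemma along_congr (q : SymSeries B D) (p : SymSeries A B) {ι ι' κ κ' : Type} [Finite ι] [Finite ι']
    [Finite κ] [Finite κ'] (e : ι ≃ ι') (d : κ ≃ κ') {φ : ι → κ} {ψ : ι' → κ'}
    (h : ∀ i, d (φ i) = ψ (e i)) {a : ι → A} {b : ι' → A} (hab : ∀ i, a i = b (e i)) :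
    along q p φ a = along q p ψ b := by
  refine q.ev_eq_of_equiv d fun k => p.ev_eq_of_equiv
    (e.subtypeEquiv fun i => ?_) fun i => hab i
  rw [← h, d.apply_eq_iff_eq]

lemma along_mk_ker (q : SymSeries B D) (p : SymSeries A B) {ι κ : Type} [Finite ι] [Finite κ]
    {φ : ι → κ} (hφ : Function.Surjective φ) (a : ι → A) :
    along q p (Quotient.mk (Setoid.ker φ)) a = along q p φ a :=
  along_congr q p (Equiv.refl ι) (Setoid.quotientKerEquivOfSurjective φ hφ) (fun _ => rfl)
    fun _ => rfl

/-- The contribution of a partition is multilinear. -/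
noncomputable def alongMultilinear (q : SymSeries B D) (p : SymSeries A B) {ι κ : Type} [Finite ι]
    [Finite κ] (φ : ι → κ) : MultilinearMap ℕ (fun _ : ι => A) D :=
  -- Changing the vector at `i` affects only the inner value of the block `φ i`, so linearity of `p`
  -- there and of `q` in that slot combine.
  have key : ∀ [DecidableEq ι] [DecidableEq κ] (a : ι → A) (i : ι) (b : A),
      (fun k => p.ev (Fibre φ k) fun x => Function.update a i b x) =
        Function.update (fun k => p.ev (Fibre φ k) fun x => a x) (φ i)
          (p.ev (Fibre φ (φ i)) (Function.update (fun x => a x) ⟨i, rfl⟩ b)) := by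
    intro _ _ a i b
    funext k
    by_cases hk : k = φ i
    · subst hk
      rw [Function.update_self]
      congr 1
      funext x
      by_cases hx : x = ⟨i, rfl⟩
      · subst hx; simp
      · rw [Function.update_of_ne hx, Function.update_of_ne fun h => hx (Subtype.ext h)]
    · rw [Function.update_of_ne hk]
      congr 1
      funext x
      refine Function.update_of_ne (fun h => hk ?_) _ _
      rw [← h, x.2]
  { toFun := along q p φ
    map_update_add' := by
      classical
      intro _ a i b c
      simp only [along, key,
        MultilinearMap.map_update_add]
    map_update_smul' := by
      classical
      intro _ a i r b
      simp only [along, key,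
        MultilinearMap.map_update_smul] }

lemma sum_along_of_equiv (q : SymSeries B D) (p : SymSeries A B) {ι ι' : Type} [Finite ι]
    [Finite ι'] (e : ι ≃ ι') {a : ι → A} {b : ι' → A} (hab : ∀ i, a i = b (e i)) :
    ∑ s : Setoid ι, along q p (Quotient.mk s) a = ∑ s : Setoid ι', along q p (Quotient.mk s) b := by
  refine Fintype.sum_equiv ⟨Setoid.comap e.symm, Setoid.comap e, fun s => ?_, fun s => ?_⟩ _ _
    fun s => ?_
  · ext x y; simp [Setoid.comap_rel]
  · ext x y; simp [Setoid.comap_rel]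
  · refine along_congr q p e (Quotient.congr e fun x y => ?_) (fun _ => rfl) hab
    change _ ↔ s (e.symm (e x)) (e.symm (e y))
    simp only [Equiv.symm_apply_apply]

/-- The composite of two symmetric series, given by Faà di Bruno's formula. -/
noncomputable def comp (q : SymSeries B D) (p : SymSeries A B) : SymSeries A D where
  term n := ∑ s : Setoid (Fin n), alongMultilinear q p (Quotient.mk s)
  symm n σ a := by
    simp only [_root_.sum_apply]
    exact sum_along_of_equiv q p σ fun _ => rfl

/-- Bridge between the sum over equivalence relations, suited to associativity, and the sum over
`OrderedFinpartition` used in `compTerm`. -/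
lemma comp_term_eq (q : SymSeries B D) (p : SymSeries A B) {n : ℕ} (a : Fin n → A) :
    (comp q p).term n a = ∑ c : OrderedFinpartition n,
      q.term c.length fun i => p.term (c.partSize i) fun b => a (c.emb i b) := by
  simp only [comp, _root_.sum_apply]
  symm
  refine Fintype.sum_equiv (Equiv.ofBijective _
    ⟨OrderedFinpartition.toSetoid_injective, OrderedFinpartition.toSetoid_surjective⟩) _ _
    fun c => ?_
  refine Eq.trans ?_ (along_mk_ker q p c.index_surjective a).symm
  rw [along, ev_fin]
  congr 1
  funext i
  rw [← ev_fin]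
  exact p.ev_eq_of_equiv (c.partEquiv i) fun _ => rfl

lemma comp_ev (q : SymSeries B D) (p : SymSeries A B) {ι : Type} [Finite ι] (a : ι → A) :
    (comp q p).ev ι a = ∑ s : Setoid ι, along q p (Quotient.mk s) a := by
  rw [← (comp q p).ev_comp_equiv (Finite.equivFin ι).symm a, ev_fin]
  simp only [comp, _root_.sum_apply]
  exact sum_along_of_equiv q p _ fun _ => rfl

open Classical in
-- For fixed `ρ`, multilinearity of `r` turns the inner sums, one per class of `ρ`, into a sum over
-- choices of an equivalence relation on every class. Such a choice is a single `π ≤ ρ`.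
lemma comp_comp_ev_left (r : SymSeries D E) (q : SymSeries B D) (p : SymSeries A B) {ι : Type}
    [Finite ι] (a : ι → A) :
    (comp r (comp q p)).ev ι a = ∑ ρ : Setoid ι, ∑ π : Setoid ι with π ≤ ρ,
      r.ev (Quotient ρ) fun c => along q p
        (Quotient.mk (π.comap (Subtype.val : Fibre (Quotient.mk ρ) c → ι))) fun x => a x := by
  have : Fintype ι := Fintype.ofFinite ι
  rw [comp_ev]
  refine Finset.sum_congr rfl fun ρ _ => ?_
  simp only [along, comp_ev, MultilinearMap.map_sum]
  -- Allows the relation on the class of `y` to be read over any equal class `c`, which avoids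
  -- transports between fibres.
  have key : ∀ (σ : ∀ c, Setoid (Fibre (Quotient.mk ρ) c)) {c : Quotient ρ} {x y : ι}
      (hx : Quotient.mk ρ x = c) (hy : Quotient.mk ρ y = c) (hxy : Quotient.mk ρ x = Quotient.mk ρ y),
      σ (Quotient.mk ρ y) ⟨x, hxy⟩ ⟨y, rfl⟩ ↔ σ c ⟨x, hx⟩ ⟨y, hy⟩ := by
    rintro σ c x y hx rfl hxy
    rfl
  let E : {π : Setoid ι // π ≤ ρ} ≃ ∀ c, Setoid (Fibre (Quotient.mk ρ) c) :=
    { toFun := fun π c => π.1.comap Subtype.val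
      invFun := fun σ => ⟨
        { r := fun x y => ∃ h : Quotient.mk ρ x = Quotient.mk ρ y, σ _ ⟨x, h⟩ ⟨y, rfl⟩
          iseqv :=
            { refl := fun x => ⟨rfl, (σ _).refl _⟩
              symm := by
                rintro x y ⟨h, h'⟩
                exact ⟨h.symm, (key σ h.symm rfl _).2 ((σ _).symm ((key σ rfl h.symm _).1 h'))⟩
              trans := by
                rintro x y z ⟨h, h1⟩ ⟨h', h2⟩
                exact ⟨h.trans h', (σ _).trans ((key σ (h.trans h') h' h).1 h1) h2⟩ } },
        fun x y h => Quotient.exact h.1⟩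
      left_inv := by
        intro π
        ext x y
        exact ⟨fun h => h.2, fun h => ⟨Quotient.sound (π.2 h), h⟩⟩
      right_inv := by
        intro σ
        funext c
        ext ⟨x, hx⟩ ⟨y, hy⟩
        exact ⟨fun h => (key σ hx hy h.1).1 h.2,
          fun h => ⟨hx.trans hy.symm, (key σ hx hy _).2 h⟩⟩ }
  symm
  rw [← Finset.sum_subtype_eq_sum_filter]
  simp only [Finset.subtype_univ]
  exact Fintype.sum_equiv E _ _ fun π => rfl

open Classical in
-- Here the finer `π` is fixed first, and equivalence relations on its set of classes correspond to
-- the `ρ` above it. What remains is to match the three nested levels of index sets.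
lemma comp_comp_ev_right (r : SymSeries D E) (q : SymSeries B D) (p : SymSeries A B) {ι : Type}
    [Finite ι] (a : ι → A) :
    (comp (comp r q) p).ev ι a = ∑ π : Setoid ι, ∑ ρ : Setoid ι with π ≤ ρ,
      r.ev (Quotient ρ) fun c => along q p
        (Quotient.mk (π.comap (Subtype.val : Fibre (Quotient.mk ρ) c → ι))) fun x => a x := by
  have : Fintype ι := Fintype.ofFinite ι
  rw [comp_ev]
  refine Finset.sum_congr rfl fun π _ => ?_
  rw [along, comp_ev, ← Finset.sum_subtype_eq_sum_filter]
  simp only [Finset.subtype_univ]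
  symm
  refine Fintype.sum_equiv (Setoid.correspondence π).toEquiv _ _ fun ρ => ?_
  obtain ⟨ρ, hρ⟩ := ρ
  set τ : Setoid (Quotient π) := (Setoid.correspondence π) ⟨ρ, hρ⟩ with hτ
  have hτρ : ∀ x y, τ (Quotient.mk π x) (Quotient.mk π y) ↔ ρ x y := fun x y => Iff.rfl
  let d : Quotient ρ ≃ Quotient τ :=
    { toFun := Quotient.lift (fun x => Quotient.mk τ (Quotient.mk π x))
        fun x y h => Quotient.sound ((hτρ x y).2 h)
      invFun := Quotient.lift (Quotient.lift (fun x => Quotient.mk ρ x)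
        fun x y h => Quotient.sound (hρ h)) fun x y => by
          induction x using Quotient.inductionOn
          induction y using Quotient.inductionOn
          exact fun h => Quotient.sound ((hτρ _ _).1 h)
      left_inv := fun c => by
        induction c using Quotient.inductionOn
        rfl
      right_inv := fun c => by
        induction c using Quotient.inductionOn with | _ c =>
        induction c using Quotient.inductionOn
        rfl }
  refine r.ev_eq_of_equiv d fun c => ?_
  -- The classes of `π` inside the class `c` of `ρ` are the points of `Quotient π` lying over `d c`.
  let m : Quotient (π.comap (Subtype.val : Fibre (Quotient.mk ρ) c → ι)) →
      Fibre (Quotient.mk τ) (d c) :=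
    Quotient.lift (fun x => ⟨Quotient.mk π x.1, congrArg d x.2⟩)
      fun x y h => Subtype.ext (Quotient.sound h)
  have hm : Function.Bijective m := by
    constructor
    · intro x y
      induction x using Quotient.inductionOn
      induction y using Quotient.inductionOn
      exact fun h => Quotient.sound (Quotient.exact (congrArg Subtype.val h) :)
    · rintro ⟨x, hx⟩
      induction x using Quotient.inductionOn with | _ x =>
      exact ⟨Quotient.mk _ ⟨x, d.injective hx⟩, rfl⟩
  refine q.ev_eq_of_equiv (Equiv.ofBijective m hm) fun e => ?_
  induction e using Quotient.inductionOn with | _ e =>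
  let f : Fibre (Quotient.mk (π.comap (Subtype.val : Fibre (Quotient.mk ρ) c → ι)))
      (Quotient.mk _ e) → Fibre (Quotient.mk π) (Quotient.mk π e.1) := fun x =>
    ⟨x.1.1, Quotient.sound (Quotient.exact x.2 :)⟩
  refine p.ev_eq_of_equiv (Equiv.ofBijective f ⟨?_, ?_⟩) fun x => rfl
  · intro x y h
    exact Subtype.ext (Subtype.ext (congrArg Subtype.val h :))
  · rintro ⟨x, hx⟩
    have h : π x e.1 := Quotient.exact hx
    exact ⟨⟨⟨x, (Quotient.sound (hρ h)).trans e.2⟩, Quotient.sound h⟩, rfl⟩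

/-- Both sides sum the same terms over chains `π ≤ ρ`, in the two orders of summation. -/
lemma comp_assoc (r : SymSeries D E) (q : SymSeries B D) (p : SymSeries A B) {n : ℕ}
    (a : Fin n → A) : (comp r (comp q p)).term n a = (comp (comp r q) p).term n a := by
  classical
  rw [← ev_fin, ← ev_fin, comp_comp_ev_left, comp_comp_ev_right]
  exact Finset.sum_comm' (by simp)

lemma ev_subsingleton {p : SymSeries A B} {ι : Type} [Finite ι] [Subsingleton ι] (i : ι)
    (a : ι → A) : p.ev ι a = p.term 1 fun _ => a i := by
  rw [← ev_fin]
  have : Unique ι := ⟨⟨i⟩, fun _ => Subsingleton.elim _ _⟩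
  exact p.ev_eq_of_equiv (Equiv.ofUnique ι (Fin 1)) fun j => congrArg a (Subsingleton.elim _ _)

lemma ev_eq_zero {p : SymSeries A B} (hp : ∀ n, n ≠ 1 → p.term n = 0) {ι : Type} [Finite ι]
    {i j : ι} (hij : i ≠ j) (a : ι → A) : p.ev ι a = 0 := by
  have : Nontrivial ι := ⟨i, j, hij⟩
  have h : Nat.card ι ≠ 1 := Finite.one_lt_card.ne'
  simp [ev, hp _ h]

/-- A block with two elements contributes zero, so only the discrete partition survives. -/
lemma comp_of_linear_right (q : SymSeries B D) {p : SymSeries A B}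
    (hp : ∀ n, n ≠ 1 → p.term n = 0) {n : ℕ} (a : Fin n → A) :
    (comp q p).term n a = q.term n fun i => p.term 1 fun _ => a i := by
  rw [← ev_fin, comp_ev, Finset.sum_eq_single ⊥, ← ev_fin]
  · refine q.ev_eq_of_equiv (Setoid.quotientBotEquiv) fun c => ?_
    induction c using Quotient.inductionOn with | _ i =>
    have : Subsingleton (Fibre (Quotient.mk (⊥ : Setoid (Fin n))) (Quotient.mk ⊥ i)) :=
      ⟨fun x y => Subtype.ext (Quotient.exact (x.2.trans y.2.symm))⟩
    exact ev_subsingleton (ι := Fibre _ _) ⟨i, rfl⟩ _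
  · intro s _ hs
    obtain ⟨x, y, hxy, hne⟩ : ∃ x y, s x y ∧ x ≠ y := by
      by_contra! h
      exact hs (eq_bot_iff.2 fun x y hxy => h x y hxy)
    refine (q.ev _).map_coord_zero (Quotient.mk s x) ?_
    exact ev_eq_zero hp (i := ⟨x, rfl⟩) (j := ⟨y, Quotient.sound (s.symm hxy)⟩)
      (fun h => hne (congrArg Subtype.val h)) _
  · simp

/-- Two distinct blocks make a summand vanish, so only the one-block partition survives. The empty
set has no block at all, hence `0 < n`. -/
lemma comp_of_linear_left {q : SymSeries B D} (hq : ∀ n, n ≠ 1 → q.term n = 0) (p : SymSeries A B)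
    {n : ℕ} (hn : 0 < n) (a : Fin n → A) :
    (comp q p).term n a = q.term 1 fun _ => p.term n a := by
  rw [← ev_fin, comp_ev, Finset.sum_eq_single ⊤]
  · have : Subsingleton (Quotient (⊤ : Setoid (Fin n))) :=
      ⟨fun x y => Quotient.inductionOn₂ x y fun _ _ => Quotient.sound trivial⟩
    rw [along, ev_subsingleton (Quotient.mk _ ⟨0, hn⟩), ← p.ev_fin]
    refine congrArg _ (funext fun _ => ?_)
    exact p.ev_eq_of_equiv (Equiv.subtypeUnivEquiv fun x => Subsingleton.elim _ _) fun _ => rfl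
  · intro s _ hs
    obtain ⟨x, y, hxy⟩ : ∃ x y, ¬ s x y := by
      by_contra! h
      exact hs (eq_top_iff.2 fun x y _ => h x y)
    exact ev_eq_zero hq (i := Quotient.mk s x) (j := Quotient.mk s y)
      (fun h => hxy (Quotient.exact h)) _
  · simp

end SymSeries

/-- A map which is additive in each variable is `ℕ`-multilinear. -/
def MultilinearMap.ofAdditive {ι A B : Type*} [AddCommMonoid A] [AddCommMonoid B]
    (f : (ι → A) → B)
    (hadd : ∀ [DecidableEq ι] (a : ι → A) (i : ι) (b c : A), f (Function.update a i (b + c)) =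
      f (Function.update a i b) + f (Function.update a i c))
    (hzero : ∀ [DecidableEq ι] (a : ι → A) (i : ι), f (Function.update a i 0) = 0) :
    MultilinearMap ℕ (fun _ : ι => A) B where
  toFun := f
  map_update_add' := hadd
  map_update_smul' a i r b := by
    induction r with
    | zero => simp [hzero]
    | succ r ih => rw [succ_nsmul, succ_nsmul, hadd, ih]

/-! ### Domains of definition, tuples and germs -/

namespace CartRes

open Restriction CartesianStructure RestrictionCategory CartesianRestrictionCategory

section below

variable {C : Type u} [Category.{v} C] [Restriction C]

/-- The domain of definition of `e` is contained in that of `f`. -/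
def Below {Z V W : C} (e : Z ⟶ W) (f : Z ⟶ V) : Prop := rs e ≫ rs f = rs e

variable {Z V W T : C}

lemma Below.trans {e : Z ⟶ W} {f : Z ⟶ V} {g : Z ⟶ T} (h : Below e f) (h' : Below f g) :
    Below e g := by
  unfold Below at *
  rw [← h, Category.assoc, h']

lemma below_of_total (e : Z ⟶ W) {f : Z ⟶ V} (hf : IsTotal f) : Below e f := by
  rw [Below, show rs f = 𝟙 _ from hf, Category.comp_id]

variable [RestrictionCategory C]

lemma Below.refl (e : Z ⟶ W) : Below e e := rs_idem e

lemma Below.of_comp {e : Z ⟶ W} {f : Z ⟶ V} {g : V ⟶ T} (h : Below e (f ≫ g)) : Below e f :=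
  h.trans (rs_comp_le f g)

lemma Below.rs_restrict {e : Z ⟶ W} {f : Z ⟶ V} (h : Below e f) : rs (rs e ≫ f) = rs e := by
  rw [rs_rs_comp, h]

lemma Below.of_rs_eq {e : Z ⟶ W} {f : Z ⟶ V} (h : rs e = rs f) : Below e f := by
  rw [Below, h, rs_idem]

lemma Below.antisymm {e : Z ⟶ W} {f : Z ⟶ V} (h : Below e f) (h' : Below f e) : rs e = rs f := by
  rw [← h, rs_comm, h']

/-- Antisymmetry of the restriction order: the hypotheses amount to `L ≤ R` and `R ≤ L`. It lets an
equation of partial maps be checked on the domain of each side separately. -/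
lemma eq_of_restrict_eq {L R : Z ⟶ V} (h₁ : rs L ≫ L = rs L ≫ R) (h₂ : rs R ≫ L = rs R ≫ R) :
    L = R := by
  rw [rs_comp_self] at h₁ h₂
  rw [← h₂]
  conv_lhs => rw [h₁]
  nth_rw 1 [← h₂]
  rw [← Category.assoc, rs_comm, Category.assoc, rs_comp_self]

end below

variable {C : Type u} [Category.{v} C] [Restriction C] [CartesianStructure C]
  [CartesianRestrictionCategory C]

lemma below_pair {Z W X Y : C} {e : Z ⟶ W} {f : Z ⟶ X} {g : Z ⟶ Y} :
    Below e (pair f g) ↔ Below e f ∧ Below e g := by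
  simp only [Below, rs_pair]
  constructor
  · intro h
    constructor
    · rw [← h, Category.assoc, Category.assoc, rs_comm g, ← Category.assoc (rs f) (rs f), rs_idem]
    · rw [← h, Category.assoc, Category.assoc, rs_idem]
  · rintro ⟨h, h'⟩
    rw [← Category.assoc, h, h']

lemma below_homAdd (M : TotalCMon C) {Z W : C} {e : Z ⟶ W} {f g : Z ⟶ M.carrier} :
    Below e (M.homAdd f g) ↔ Below e f ∧ Below e g := by
  rw [← below_pair, Below, Below, M.rs_homAdd, rs_pair]

lemma homZero_total (M : TotalCMon C) (Z : C) : IsTotal (M.homZero Z) :=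
  total_comp (bang_total Z) M.zero_total

lemma comp_homZero (M : TotalCMon C) {W Z : C} (h : W ⟶ Z) :
    h ≫ M.homZero Z = rs h ≫ M.homZero W := by
  rw [TotalCMon.homZero, ← Category.assoc, comp_bang, Category.assoc]; rfl

/-! ### Tuples -/

lemma below_tuple {Z W A X : C} {e : Z ⟶ W} {n : ℕ} {a : Fin n → (Z ⟶ A)} {x : Z ⟶ X} :
    Below e (tuple a x) ↔ (∀ i, Below e (a i)) ∧ Below e x := by
  induction n with
  | zero => exact ⟨fun h => ⟨fun i => i.elim0, h⟩, fun h => h.2⟩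
  | succ n ih =>
    change Below e (pair (a 0) (tuple (fun i => a i.succ) x)) ↔ _
    rw [below_pair, ih, Fin.forall_fin_succ, and_assoc]

lemma comp_tuple {Y Z A X : C} (h : Y ⟶ Z) {n : ℕ} (a : Fin n → (Z ⟶ A)) (x : Z ⟶ X) :
    h ≫ tuple a x = tuple (fun i => h ≫ a i) (h ≫ x) := by
  induction n with
  | zero => rfl
  | succ n ih =>
    change h ≫ pair (a 0) (tuple (fun i => a i.succ) x) = pair _ (tuple _ _)
    rw [comp_pair, ih]

lemma projLast_total (A X : C) (n : ℕ) : IsTotal (projLast A X n) := by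
  induction n with
  | zero => exact rs_id X
  | succ n ih => exact total_comp (snd_total _ _) ih

lemma proj_total (A X : C) {n : ℕ} (i : Fin n) : IsTotal (proj A X i) := by
  induction n with
  | zero => exact i.elim0
  | succ n ih =>
    refine Fin.cases ?_ (fun j => ?_) i
    · exact fst_total _ _
    · exact total_comp (snd_total _ _) (ih j)

lemma rs_tuple_succ {Z A X : C} {n : ℕ} (a : Fin (n + 1) → (Z ⟶ A)) (x : Z ⟶ X) :
    rs (tuple a x) = rs (a 0) ≫ rs (tuple (fun i => a i.succ) x) :=
  rs_pair _ _

lemma tuple_projLast {Z A X : C} {n : ℕ} (a : Fin n → (Z ⟶ A)) (x : Z ⟶ X) :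
    tuple a x ≫ projLast A X n = rs (tuple a x) ≫ x := by
  induction n with
  | zero => exact (Category.comp_id _).trans (rs_comp_self x).symm
  | succ n ih =>
    change pair _ _ ≫ snd _ _ ≫ _ = _
    rw [← Category.assoc, pair_snd, Category.assoc, ih, rs_tuple_succ, Category.assoc]

lemma tuple_proj {Z A X : C} {n : ℕ} (a : Fin n → (Z ⟶ A)) (x : Z ⟶ X) (i : Fin n) :
    tuple a x ≫ proj A X i = rs (tuple a x) ≫ a i := by
  induction n with
  | zero => exact i.elim0
  | succ n ih =>
    refine Fin.cases ?_ (fun j => ?_) i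
    · change pair _ _ ≫ fst _ _ = _
      rw [pair_fst, rs_tuple_succ, rs_comm, Category.assoc, rs_comp_self]
    · change pair _ _ ≫ snd _ _ ≫ proj A X j = _
      rw [← Category.assoc, pair_snd, Category.assoc, ih, rs_tuple_succ, Category.assoc]

lemma tuple_proj_projLast (A X : C) (n : ℕ) :
    tuple (fun i => proj A X i) (projLast A X n) = 𝟙 (pow A X n) := by
  induction n with
  | zero => rfl
  | succ n ih =>
    change pair (fst _ _) (tuple (fun i => snd _ _ ≫ proj A X i) (snd _ _ ≫ projLast A X n)) = _
    rw [← comp_tuple, ih, Category.comp_id, pair_fst_snd]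
    rfl

lemma rs_tuple {Z W A X : C} {e : Z ⟶ W} {n : ℕ} {a : Fin n → (Z ⟶ A)} {x : Z ⟶ X}
    (ha : ∀ i, rs (a i) = rs e) (hx : rs x = rs e) : rs (tuple a x) = rs e := by
  refine Below.antisymm ?_ (below_tuple.2 ⟨fun i => .of_rs_eq (ha i).symm, .of_rs_eq hx.symm⟩)
  exact (below_tuple.1 (Below.refl (tuple a x))).2.trans (.of_rs_eq hx)

lemma rs_tuple_comp {Z A X Y B : C} {n : ℕ} {K : pow A X n ⟶ B} {s : X ⟶ Y}
    (hK : rs K = rs (projLast A X n ≫ s)) (a : Fin n → (Z ⟶ A)) (x : Z ⟶ X) :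
    rs (tuple a x ≫ K) = rs (tuple a x) ≫ rs (x ≫ s) := by
  rw [← rs_comp_rs, hK, rs_comp_rs, ← Category.assoc, tuple_projLast, Category.assoc, rs_rs_comp]

/-- Definedness of `x` need not be listed, since it follows from that of `x ≫ s`. -/
lemma below_tuple_comp {Z W A X Y B : C} {n : ℕ} {K : pow A X n ⟶ B} {s : X ⟶ Y}
    (hK : rs K = rs (projLast A X n ≫ s)) {e : Z ⟶ W} {a : Fin n → (Z ⟶ A)} {x : Z ⟶ X} :
    Below e (tuple a x ≫ K) ↔ (∀ i, Below e (a i)) ∧ Below e (x ≫ s) := by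
  have h : Below e (tuple a x ≫ K) ↔ Below e (pair (tuple a x) (x ≫ s)) := by
    rw [Below, Below, rs_tuple_comp hK, rs_pair]
  rw [h, below_pair, below_tuple]
  exact ⟨fun h => ⟨h.1.1, h.2⟩, fun h => ⟨⟨h.1, h.2.of_comp⟩, h.2⟩⟩

/-! ### Maps into a monoid with a fixed domain of definition -/

/-- The maps into a commutative monoid whose domain of definition is that of `e`. -/
@[ext]
structure Germ (M : TotalCMon C) {Z W : C} (e : Z ⟶ W) where
  val : Z ⟶ M.carrier
  rs_val : rs val = rs e

namespace Germ

variable {M : TotalCMon C} {Z W : C} {e : Z ⟶ W}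

instance : Add (Germ M e) where
  add f g := ⟨M.homAdd f.1 g.1, by rw [M.rs_homAdd, f.2, g.2, rs_idem]⟩

instance : Zero (Germ M e) where
  zero := ⟨rs e ≫ M.homZero Z, (below_of_total e (homZero_total M Z)).rs_restrict⟩

lemma val_add (f g : Germ M e) : (f + g).1 = M.homAdd f.1 g.1 := rfl

lemma val_zero : (0 : Germ M e).1 = rs e ≫ M.homZero Z := rfl

instance : AddCommMonoid (Germ M e) where
  add_assoc f g h := Germ.ext (M.homAdd_assoc f.1 g.1 h.1)
  zero_add f := Germ.ext (by
    change M.homAdd (rs e ≫ M.homZero Z) f.1 = f.1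
    rw [TotalCMon.homAdd, pair_rs_left, Category.assoc, ← f.rs_val]
    exact (congrArg _ (M.homZero_add f.1)).trans (rs_comp_self f.1))
  add_zero f := Germ.ext (by
    change M.homAdd f.1 (rs e ≫ M.homZero Z) = f.1
    rw [TotalCMon.homAdd, pair_rs_right, Category.assoc, ← f.2]
    exact (congrArg _ ((M.homAdd_comm _ _).trans (M.homZero_add f.1))).trans (rs_comp_self f.1))
  add_comm f g := Germ.ext (M.homAdd_comm f.1 g.1)
  nsmul := nsmulRec

/-- An empty sum of germs is zero cut down to the domain of `e`, whereas `homSum` would give the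
total zero; hence `Nonempty ι`. -/
lemma val_sum {ι : Type*} [Fintype ι] [Nonempty ι] (k : ι → Germ M e) :
    (∑ i, k i).1 = M.homSum fun i => (k i).1 := by
  let _ := M.homAddCommMonoid Z
  have h : ∀ s : Finset ι, s.Nonempty → (∑ i ∈ s, k i).1 = ∑ i ∈ s, (k i).1 := by
    intro s hs
    induction hs using Finset.Nonempty.cons_induction with
    | singleton a => simp
    | cons a s ha hs ih =>
      rw [Finset.sum_cons, Finset.sum_cons, val_add, ih]
      rfl
  exact h _ Finset.univ_nonempty

/-- The restriction of a map to a smaller domain of definition. -/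
def restrict {f : Z ⟶ M.carrier} (h : Below e f) : Germ M e := ⟨rs e ≫ f, h.rs_restrict⟩

end Germ

/-- Nonemptiness is essential: precomposing the total zero with `h` restricts it to the domain of
`h`. -/
lemma comp_homSum (M : TotalCMon C) {Z Y : C} (h : Y ⟶ Z) {ι : Type*} [Fintype ι] [Nonempty ι]
    (k : ι → (Z ⟶ M.carrier)) : h ≫ M.homSum k = M.homSum fun i => h ≫ k i := by
  let _ := M.homAddCommMonoid Z
  let _ := M.homAddCommMonoid Y
  have H : ∀ s : Finset ι, s.Nonempty → h ≫ (∑ i ∈ s, k i) = ∑ i ∈ s, h ≫ k i := by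
    intro s hs
    induction hs using Finset.Nonempty.cons_induction with
    | singleton a => simp
    | cons a s ha hs ih =>
      rw [Finset.sum_cons, Finset.sum_cons, ← ih]
      exact M.comp_homAdd h _ _
  exact H _ Finset.univ_nonempty

section germ

variable {A B : TotalCMon C} {X Y : C} {n : ℕ}

set_option linter.unusedSectionVars false in
lemma update_val {Z W : C} {e : Z ⟶ W} (a : Fin n → Germ A e) (i : Fin n) (b : Germ A e) :
    (fun j => (Function.update a i b j).1) = Function.update (fun j => (a j).1) i b.1 := by
  funext j
  exact Function.apply_update (fun _ => Germ.val) a i b j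

/-- Replaces vectors with various domains by germs, which brings the multilinearity of a series to
bear on arbitrary families. -/
lemma restrict_tuple {Z W : C} {e : Z ⟶ W} (a : Fin n → (Z ⟶ A.carrier)) (x : Z ⟶ X)
    (h : ∀ i, Below e (a i)) (K : pow A.carrier X n ⟶ B.carrier) :
    rs e ≫ tuple a x ≫ K =
      tuple (fun i => (Germ.restrict (h i)).1) (rs e ≫ x) ≫ K := by
  rw [← Category.assoc, comp_tuple]
  rfl

/-- Two maps `A^n × X ⟶ B` with the domain of `π_n ≫ s` agree when they agree on families with
a common domain of definition. -/
lemma eq_of_germ {K L : pow A.carrier X n ⟶ B.carrier} {s : X ⟶ Y}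
    (hK : rs K = rs (projLast A.carrier X n ≫ s)) (hL : rs L = rs (projLast A.carrier X n ≫ s))
    (H : ∀ {Z W : C} (e : Z ⟶ W) (x : Z ⟶ X), rs x = rs e → rs (x ≫ s) = rs e →
      ∀ a : Fin n → Germ A e, tuple (fun i => (a i).1) x ≫ K = tuple (fun i => (a i).1) x ≫ L) :
    K = L := by
  -- The test family is the generic one: the projections, restricted to the common domain of `K` and
  -- `L`.
  set e := projLast A.carrier X n ≫ s with he
  have h : ∀ i, Below e (proj A.carrier X i) := fun i => below_of_total e (proj_total _ _ i)
  have hx : Below e (projLast A.carrier X n) := below_of_total e (projLast_total _ _ _)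
  have key : ∀ K : pow A.carrier X n ⟶ B.carrier, rs K = rs e →
      K = tuple (fun i => (Germ.restrict (h i)).1) (rs e ≫ projLast A.carrier X n) ≫ K := by
    intro K hK
    rw [← restrict_tuple, tuple_proj_projLast, ← hK, Category.id_comp, rs_comp_self]
  rw [key K hK, key L hL]
  refine H e _ hx.rs_restrict ?_ _
  rw [Category.assoc, ← he, rs_comp_self]

/-- A map which on families with a common domain of definition is given by a symmetric series is
symmetric. -/
lemma isSymmetric_of_germ {K : pow A.carrier X n ⟶ B.carrier} {s : X ⟶ Y}
    (hK : rs K = rs (projLast A.carrier X n ≫ s))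
    (H : ∀ {Z W : C} (e : Z ⟶ W) (x : Z ⟶ X), rs x = rs e → rs (x ≫ s) = rs e →
      ∃ p : SymSeries (Germ A e) (Germ B e),
        ∀ a : Fin n → Germ A e, tuple (fun i => (a i).1) x ≫ K = (p.term n a).1) :
    IsSymmetric K := by
  intro σ Z a x
  -- The entries of `a` may have different domains; on any domain contained in all of them and in
  -- that of `x ≫ s` they become germs, and the symmetry of `p` applies.
  have key : ∀ e : Z ⟶ B.carrier, (∀ i, Below e (a i)) → Below e (x ≫ s) →
      rs e ≫ tuple (fun i => a (σ i)) x ≫ K = rs e ≫ tuple a x ≫ K := by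
    intro e ha hx
    obtain ⟨p, hp⟩ := H e (rs e ≫ x) hx.of_comp.rs_restrict
      (by rw [Category.assoc, hx.rs_restrict])
    rw [restrict_tuple _ _ (fun i => ha (σ i)), restrict_tuple _ _ ha, hp, hp]
    exact congrArg _ (p.symm n σ fun i => Germ.restrict (ha i))
  apply eq_of_restrict_eq
  · have h := (below_tuple_comp hK).1 (Below.refl (tuple (fun i => a (σ i)) x ≫ K))
    exact key _ (fun i => by simpa using h.1 (σ.symm i)) h.2
  · have h := (below_tuple_comp hK).1 (Below.refl (tuple a x ≫ K))
    exact key _ h.1 h.2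

lemma isAdditive_of_germ {K : pow A.carrier X n ⟶ B.carrier} {s : X ⟶ Y}
    (hK : rs K = rs (projLast A.carrier X n ≫ s))
    (H : ∀ {Z W : C} (e : Z ⟶ W) (x : Z ⟶ X), rs x = rs e → rs (x ≫ s) = rs e →
      ∃ p : SymSeries (Germ A e) (Germ B e),
        ∀ a : Fin n → Germ A e, tuple (fun i => (a i).1) x ≫ K = (p.term n a).1) :
    IsAdditive A B K := by
  -- An updated family carries no information on the old `a i`; its definedness is obtained below
  -- from the sum `a i + b` or from the unmodified summand.
  have hupd : ∀ {Z W : C} (e : Z ⟶ W) {a : Fin n → (Z ⟶ A.carrier)} {i : Fin n}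
      {b : Z ⟶ A.carrier}, (∀ j, Below e (Function.update a i b j)) ↔
        (∀ j, j ≠ i → Below e (a j)) ∧ Below e b := by
    intro Z W e a i b
    rw [Function.forall_update_iff a fun _ f => Below e f, and_comm]
  constructor
  · intro Z a x i b
    have key : ∀ e : Z ⟶ B.carrier, (∀ i, Below e (a i)) → Below e b → Below e (x ≫ s) →
        rs e ≫ tuple (Function.update a i (A.homAdd (a i) b)) x ≫ K =
          rs e ≫ B.homAdd (tuple a x ≫ K) (tuple (Function.update a i b) x ≫ K) := by
      intro e ha hb hx
      obtain ⟨p, hp⟩ := H e (rs e ≫ x) hx.of_comp.rs_restrict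
        (by rw [Category.assoc, hx.rs_restrict])
      rw [B.comp_homAdd, restrict_tuple _ _ ha,
        restrict_tuple _ _ ((hupd e).2 ⟨fun j _ => ha j, hb⟩),
        restrict_tuple _ _ ((hupd e).2 ⟨fun j _ => ha j, (below_homAdd A).2 ⟨ha i, hb⟩⟩),
        hp, hp, hp, ← Germ.val_add]
      have h := (p.term n).map_update_add (fun j => Germ.restrict (ha j)) i
        (Germ.restrict (ha i)) (Germ.restrict hb)
      rw [Function.update_eq_self_iff.2 rfl] at h
      have h₁ : ∀ (c : Z ⟶ A.carrier) (hc : Below e c)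
          (hc' : ∀ j, Below e (Function.update a i c j)),
          (fun j => (Germ.restrict (hc' j) : Germ A e)) =
            Function.update (fun j => Germ.restrict (ha j)) i (Germ.restrict hc) := by
        intro c hc hc'
        funext j
        apply Germ.ext
        by_cases hj : j = i
        · subst hj
          simp [Germ.restrict]
        · simp [Germ.restrict, hj]
      rw [h₁ _ hb, h₁ _ ((below_homAdd A).2 ⟨ha i, hb⟩), ← h]
      congr 4
      exact Germ.ext (A.comp_homAdd _ _ _)
    apply eq_of_restrict_eq
    · have h := (below_tuple_comp hK).1
        (Below.refl (tuple (Function.update a i (A.homAdd (a i) b)) x ≫ K))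
      rw [hupd, below_homAdd] at h
      refine key _ (fun j => ?_) h.1.2.2 h.2
      by_cases hj : j = i
      · exact hj ▸ h.1.2.1
      · exact h.1.1 j hj
    · have h := (below_homAdd B).1
        (Below.refl (B.homAdd (tuple a x ≫ K) (tuple (Function.update a i b) x ≫ K)))
      rw [below_tuple_comp hK, below_tuple_comp hK, hupd] at h
      exact key _ h.1.1 h.2.1.2 h.1.2
  · intro Z a x i
    -- Both sides are already restricted to the domain of `L`, so this one domain suffices.
    set L := tuple (Function.update a i (A.homZero Z)) x ≫ K with hL
    have h := (below_tuple_comp hK).1 (Below.refl L)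
    obtain ⟨p, hp⟩ := H L (rs L ≫ x) h.2.of_comp.rs_restrict
      (by rw [Category.assoc, h.2.rs_restrict])
    have h₁ := restrict_tuple _ x h.1 K
    rw [hp, (p.term n).map_coord_zero i, ← hL, rs_comp_self] at h₁
    · exact h₁
    · apply Germ.ext
      simp [Germ.restrict, Germ.val_zero]

end germ

end CartRes

namespace CartRes

open Restriction CartesianStructure RestrictionCategory CartesianRestrictionCategory

variable {C : Type u} [Category.{v} C] [Restriction C] [CartesianStructure C]
  [CartesianRestrictionCategory C]

/-! ### Substituting germs into components -/

section substitution

variable {A B D : TotalCMon C} {X Y V : C} {n k : ℕ}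

/-- The zero germ is the total zero restricted to the domain of `e`; factoring out `rs e` reduces
the claim to the second clause of additivity. -/
lemma IsAdditive.germ_zero {K : pow A.carrier X n ⟶ B.carrier} (hK : IsAdditive A B K) {Z W : C}
    {e : Z ⟶ W} (a : Fin n → Germ A e) {x : Z ⟶ X} (hx : rs x = rs e) (i : Fin n)
    (h : rs (tuple (fun j => (Function.update a i 0 j).1) x ≫ K) = rs e) :
    tuple (fun j => (Function.update a i 0 j).1) x ≫ K = rs e ≫ B.homZero Z := by
  have h₁ : (fun j => (Function.update a i 0 j).1) =
      fun j => rs e ≫ Function.update (fun j => (a j).1) i (A.homZero Z) j := by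
    funext j
    by_cases hj : j = i
    · subst hj; simp [Germ.val_zero]
    · simp only [Function.update_of_ne hj]
      rw [← (a j).2, rs_comp_self]
  have hx' : rs e ≫ x = x := by rw [← hx, rs_comp_self]
  have h₂ : tuple (fun j => (Function.update a i 0 j).1) x =
      rs e ≫ tuple (Function.update (fun j => (a j).1) i (A.homZero Z)) x := by
    rw [h₁, comp_tuple, hx']
  rw [h₂, Category.assoc] at h ⊢
  rw [hK.2, ← Category.assoc, ← rs_rs_comp, h]

/-- Projecting from a tuple of partial maps leaves behind the restriction of the tuple. Here it is
absorbed, as all entries have the domain of `e`. -/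
lemma tuple_comp_tuple {Z W : C} {e : Z ⟶ W} (a : Fin n → Germ A e) {x : Z ⟶ X}
    (hx : rs x = rs e) (m : Fin k → ℕ) (ν : ∀ j, Fin (m j) → Fin n)
    (K : ∀ j, pow A.carrier X (m j) ⟶ B.carrier) (s : X ⟶ Y) (L : pow B.carrier Y k ⟶ D.carrier) :
    tuple (fun i => (a i).1) x ≫ tuple (fun j => tuple (fun b => proj A.carrier X (ν j b))
      (projLast A.carrier X n) ≫ K j) (projLast A.carrier X n ≫ s) ≫ L =
    tuple (fun j => tuple (fun b => (a (ν j b)).1) x ≫ K j) (x ≫ s) ≫ L := by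
  have h : rs (tuple (fun i => (a i).1) x) = rs e := rs_tuple (fun i => (a i).2) hx
  have ha : ∀ i, rs e ≫ (a i).1 = (a i).1 := fun i => by rw [← (a i).2, rs_comp_self]
  have hx' : rs e ≫ x = x := by rw [← hx, rs_comp_self]
  rw [← Category.assoc, comp_tuple, ← Category.assoc, tuple_projLast, h, hx']
  simp only [← Category.assoc, comp_tuple, tuple_projLast, h, hx', tuple_proj, ha]

lemma rs_tuple_comp_tuple (m : Fin k → ℕ) (ν : ∀ j, Fin (m j) → Fin n)
    {K : ∀ j, pow A.carrier X (m j) ⟶ B.carrier} {s : X ⟶ Y}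
    (hK : ∀ j, rs (K j) = rs (projLast A.carrier X (m j) ≫ s))
    {L : pow B.carrier Y k ⟶ D.carrier} {t : Y ⟶ V}
    (hL : rs L = rs (projLast B.carrier Y k ≫ t)) :
    rs (tuple (fun j => tuple (fun b => proj A.carrier X (ν j b))
      (projLast A.carrier X n) ≫ K j) (projLast A.carrier X n ≫ s) ≫ L) =
    rs (projLast A.carrier X n ≫ s ≫ t) := by
  have h : ∀ j, rs (tuple (fun b => proj A.carrier X (ν j b)) (projLast A.carrier X n) ≫ K j) =
      rs (projLast A.carrier X n ≫ s) := by
    intro j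
    rw [rs_tuple_comp (hK j), rs_tuple (e := 𝟙 _), rs_id, Category.id_comp]
    · exact fun i => (proj_total _ _ _).trans (rs_id _).symm
    · exact (projLast_total _ _ _).trans (rs_id _).symm
  rw [rs_tuple_comp hL, rs_tuple h rfl, Category.assoc, rs_comm, ← Category.assoc, rs_comp_le]

end substitution

/-! ### The series of a map, and composition -/

namespace FaaHom

variable {P Q R T : FaaObj C}

/-- The `n`-th component of a map, evaluated at families of vectors over the point `x`. -/
def germTerm (f : FaaHom P Q) {Z W : C} (e : Z ⟶ W) (x : Z ⟶ P.pt) (hx : rs x = rs e)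
    (hf : rs (x ≫ f.star) = rs e) (n : ℕ) (hn : 0 < n) (a : Fin n → Germ P.vec e) :
    Germ Q.vec e where
  val := tuple (fun i => (a i).1) x ≫ f.term n hn
  rs_val := by
    rw [rs_tuple_comp (f.rs_term n hn), rs_tuple (e := e) (fun i => (a i).2) hx, hf, rs_idem]

/-- The symmetric series of a map at the point `x`. -/
def series (f : FaaHom P Q) {Z W : C} (e : Z ⟶ W) (x : Z ⟶ P.pt) (hx : rs x = rs e)
    (hf : rs (x ≫ f.star) = rs e) : SymSeries (Germ P.vec e) (Germ Q.vec e) where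
  term n := if hn : 0 < n then
      MultilinearMap.ofAdditive (f.germTerm e x hx hf n hn)
        (by
          intro inst a i b c
          obtain rfl : inst = instDecidableEqFin n := Subsingleton.elim _ _
          apply Germ.ext
          have h := (f.additive n hn).1 (fun j => (Function.update a i b j).1) x i c.1
          simp only [germTerm, Germ.val_add, update_val, Function.update_idem,
            Function.update_self] at h ⊢
          exact h)
        (by
          intro inst a i
          obtain rfl : inst = instDecidableEqFin n := Subsingleton.elim _ _
          exact Germ.ext ((f.additive n hn).germ_zero a hx i
            (f.germTerm e x hx hf n hn (Function.update a i 0)).rs_val))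
    -- Maps have no component in degree zero. The default `0` is stable under composition, since the
    -- only partition of the empty set has no blocks and evaluates the outer degree-zero term.
    else 0
  symm n σ a := by
    by_cases hn : 0 < n
    · simp only [hn, dif_pos]
      exact Germ.ext (f.symmetric n hn σ (fun i => (a i).1) x)
    · simp only [hn, dif_neg, not_false_eq_true]
      rfl

lemma series_congr (f : FaaHom P Q) {Z W : C} {e : Z ⟶ W} {x y : Z ⟶ P.pt} (h : x = y)
    (hx : rs x = rs e) (hfx : rs (x ≫ f.star) = rs e) (hy : rs y = rs e)
    (hfy : rs (y ≫ f.star) = rs e) : f.series e x hx hfx = f.series e y hy hfy := by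
  subst h; rfl

lemma val_series_term (f : FaaHom P Q) {Z W : C} (e : Z ⟶ W) (x : Z ⟶ P.pt) (hx : rs x = rs e)
    (hf : rs (x ≫ f.star) = rs e) (n : ℕ) (hn : 0 < n) (a : Fin n → Germ P.vec e) :
    ((f.series e x hx hf).term n a).1 = tuple (fun i => (a i).1) x ≫ f.term n hn := by
  simp only [series, hn, dif_pos]
  rfl

lemma tuple_compSummand (f : FaaHom P Q) (g : FaaHom Q R) {n : ℕ} (hn : 0 < n)
    (τ : OrderedFinpartition n) {Z W : C} (e : Z ⟶ W) (x : Z ⟶ P.pt) (hx : rs x = rs e)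
    (a : Fin n → Germ P.vec e) :
    tuple (fun i => (a i).1) x ≫ compSummand f g hn τ =
      tuple (fun j => tuple (fun b => (a (τ.emb j b)).1) x ≫
        f.term (τ.partSize j) (τ.partSize_pos j)) (x ≫ f.star) ≫
      g.term τ.length (τ.length_pos hn) := 
  tuple_comp_tuple a hx _ _ (fun j => f.term _ (τ.partSize_pos j)) _ _

lemma rs_compSummand (f : FaaHom P Q) (g : FaaHom Q R) {n : ℕ} (hn : 0 < n)
    (τ : OrderedFinpartition n) : rs (compSummand f g hn τ) =
      rs (projLast P.vec.carrier P.pt n ≫ f.star ≫ g.star) := 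
  rs_tuple_comp_tuple _ _ (fun j => f.rs_term _ (τ.partSize_pos j)) (g.rs_term _ (τ.length_pos hn))

instance (n : ℕ) : Nonempty (OrderedFinpartition n) := ⟨default⟩

/-- All summands have the same domain, so they are germs over one map, and so is their nonempty sum.
-/
lemma rs_compTerm (f : FaaHom P Q) (g : FaaHom Q R) (n : ℕ) (hn : 0 < n) :
    rs (compTerm f g n hn) = rs (projLast P.vec.carrier P.pt n ≫ f.star ≫ g.star) :=
  (congrArg rs (Germ.val_sum fun τ => ⟨compSummand f g hn τ, rs_compSummand f g hn τ⟩)).symm.trans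
    (Germ.rs_val _)

/-- The domain of `x ≫ f.star` is squeezed between those of `x ≫ f.star ≫ g` and `x`. -/
lemma rs_comp_star_left {f : FaaHom P Q} {g : Q.pt ⟶ R.pt} {Z W : C} {e : Z ⟶ W}
    {x : Z ⟶ P.pt} (hx : rs x = rs e) (hfg : rs (x ≫ f.star ≫ g) = rs e) :
    rs (x ≫ f.star) = rs e := by
  refine Below.antisymm ((show Below (x ≫ f.star) x from rs_comp_le _ _).trans (Below.of_rs_eq hx)) ?_
  rw [← Category.assoc] at hfg
  exact (Below.of_rs_eq hfg.symm).of_comp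

/-- The transfer principle: symmetry, additivity and associativity of composites are inherited from
series over ordinary monoids. -/
lemma tuple_compTerm (f : FaaHom P Q) (g : FaaHom Q R) {Z W : C} (e : Z ⟶ W) (x : Z ⟶ P.pt)
    (hx : rs x = rs e) (hf : rs (x ≫ f.star) = rs e) (hg : rs ((x ≫ f.star) ≫ g.star) = rs e)
    (n : ℕ) (hn : 0 < n) (a : Fin n → Germ P.vec e) :
    tuple (fun i => (a i).1) x ≫ compTerm f g n hn =
      (((g.series e (x ≫ f.star) hf hg).comp (f.series e x hx hf)).term n a).1 := by
  rw [SymSeries.comp_term_eq, Germ.val_sum]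
  refine (comp_homSum _ _ _).trans (congrArg _ ?_)
  funext τ
  rw [tuple_compSummand f g hn τ e x hx, val_series_term _ _ _ _ _ _ (τ.length_pos hn)]
  congr 2
  funext j
  exact (val_series_term _ _ _ _ _ _ (τ.partSize_pos j) _).symm

/-- The composite of two maps. -/
noncomputable def comp (f : FaaHom P Q) (g : FaaHom Q R) : FaaHom P R where
  star := f.star ≫ g.star
  term := compTerm f g
  rs_term := rs_compTerm f g
  symmetric n hn := isSymmetric_of_germ (rs_compTerm f g n hn) fun e x hx hfg =>
    ⟨_, tuple_compTerm f g e x hx (rs_comp_star_left hx hfg)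
      (by rw [Category.assoc, hfg]) n hn⟩
  additive n hn := isAdditive_of_germ (rs_compTerm f g n hn) fun e x hx hfg =>
    ⟨_, tuple_compTerm f g e x hx (rs_comp_star_left hx hfg)
      (by rw [Category.assoc, hfg]) n hn⟩

/-- Maps with equal series at all points are equal. -/
lemma ext_series {f g : FaaHom P Q} (h : f.star = g.star)
    (H : ∀ {Z W : C} (e : Z ⟶ W) (x : Z ⟶ P.pt) (hx : rs x = rs e) (hf : rs (x ≫ f.star) = rs e)
      (hg : rs (x ≫ g.star) = rs e) (n : ℕ) (_ : 0 < n) (a : Fin n → Germ P.vec e),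
      (f.series e x hx hf).term n a = (g.series e x hx hg).term n a) : f = g := by
  refine FaaHom.ext h (funext fun n => funext fun hn => ?_)
  refine eq_of_germ (f.rs_term n hn) (h ▸ g.rs_term n hn) fun e x hx hf a => ?_
  rw [← f.val_series_term e x hx hf, ← g.val_series_term e x hx (h ▸ hf),
    H e x hx hf (h ▸ hf) n hn]

lemma series_comp (f : FaaHom P Q) (g : FaaHom Q R) {Z W : C} (e : Z ⟶ W) (x : Z ⟶ P.pt)
    (hx : rs x = rs e) (hf : rs (x ≫ f.star) = rs e) (hg : rs ((x ≫ f.star) ≫ g.star) = rs e)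
    (hfg : rs (x ≫ (comp f g).star) = rs e) :
    (comp f g).series e x hx hfg = (g.series e (x ≫ f.star) hf hg).comp (f.series e x hx hf) := by
  apply SymSeries.ext
  funext n
  ext a : 1
  rcases Nat.eq_zero_or_pos n with rfl | hn
  · rw [SymSeries.comp_term_eq, Fintype.sum_eq_zero]
    · rfl
    · intro c
      simp [series, Nat.le_zero.1 c.length_le]
  · apply Germ.ext
    rw [val_series_term _ _ _ _ _ _ hn]
    exact tuple_compTerm f g e x hx hf hg n hn a

lemma comp_assoc (f : FaaHom P Q) (g : FaaHom Q R) (h : FaaHom R T) :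
    comp (comp f g) h = comp f (comp g h) := by
  refine ext_series (Category.assoc _ _ _) fun {Z W} e x hx h₁ h₂ n hn a => ?_
  -- All intermediate points have the domain of `e`, so every map involved has a series there.
  have hf : rs (x ≫ f.star) = rs e := rs_comp_star_left (g := g.star ≫ h.star) hx h₂
  have hgh : rs ((x ≫ f.star) ≫ g.star ≫ h.star) = rs e := by rw [Category.assoc]; exact h₂
  have hg : rs ((x ≫ f.star) ≫ g.star) = rs e := rs_comp_star_left hf hgh
  have hh : rs (((x ≫ f.star) ≫ g.star) ≫ h.star) = rs e := by rw [Category.assoc]; exact hgh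
  have hgh' : rs ((x ≫ f.star) ≫ (comp g h).star) = rs e := hgh
  have hE : x ≫ (comp f g).star = (x ≫ f.star) ≫ g.star := (Category.assoc _ _ _).symm
  have hfg : rs (x ≫ (comp f g).star) = rs e := by
    change rs (x ≫ f.star ≫ g.star) = _
    rw [← Category.assoc, hg]
  have hh' : rs ((x ≫ (comp f g).star) ≫ h.star) = rs e := by
    rw [Category.assoc]; exact h₁
  rw [series_comp (comp f g) h e x hx hfg hh', series_comp f (comp g h) e x hx hf hgh',
    series_comp f g e x hx hf hg, series_comp g h e _ hf hg hh, SymSeries.comp_assoc,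
    h.series_congr hE hfg hh' hg hh]

end FaaHom

end CartRes

/-! ### Linear maps, identities and restrictions -/

/-- The symmetric series with linear term `v` and no other terms. -/
def SymSeries.linear {A B : Type*} [AddCommMonoid A] [AddCommMonoid B] (v : A →+ B) :
    SymSeries A B where
  term
    | 1 => MultilinearMap.ofAdditive (fun a => v (a 0))
        (by
          intro _ a i b c
          obtain rfl : i = 0 := Subsingleton.elim _ _
          simp)
        (by
          intro _ a i
          obtain rfl : i = 0 := Subsingleton.elim _ _
          simp)
    | _ => 0
  symm n σ a := by
    match n with
    | 0 => rfl
    | 1 => exact congrArg v (congrArg a (Subsingleton.elim _ _))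
    | _ + 2 => rfl

lemma SymSeries.linear_term_of_ne {A B : Type*} [AddCommMonoid A] [AddCommMonoid B] (v : A →+ B)
    (n : ℕ) (hn : n ≠ 1) : (SymSeries.linear v).term n = 0 := by
  match n with
  | 0 => rfl
  | 1 => exact absurd rfl hn
  | _ + 2 => rfl

lemma SymSeries.linear_term_one {A B : Type*} [AddCommMonoid A] [AddCommMonoid B] (v : A →+ B)
    (a : Fin 1 → A) : (SymSeries.linear v).term 1 a = v (a 0) := rfl

namespace CartRes

open Restriction CartesianStructure RestrictionCategory CartesianRestrictionCategory

variable {C : Type u} [Category.{v} C] [Restriction C] [CartesianStructure C]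
  [CartesianRestrictionCategory C]

/-- A total map of commutative monoids. -/
structure IsTotalHom (A B : TotalCMon C) (u : A.carrier ⟶ B.carrier) : Prop where
  total : IsTotal u
  map_add : ∀ {Z : C} (a b : Z ⟶ A.carrier), A.homAdd a b ≫ u = B.homAdd (a ≫ u) (b ≫ u)
  map_zero : ∀ Z : C, A.homZero Z ≫ u = B.homZero Z

section linear

variable {A B : TotalCMon C} {X Y : C}

/-- The action of a map of commutative monoids on germs. -/
def IsTotalHom.germ {u : A.carrier ⟶ B.carrier} (hu : IsTotalHom A B u) {Z W : C} (e : Z ⟶ W) :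
    Germ A e →+ Germ B e where
  toFun k := ⟨k.1 ≫ u, (rs_comp_total _ hu.total).trans k.2⟩
  map_zero' := Germ.ext (by simp only [Germ.val_zero, Category.assoc, hu.map_zero])
  map_add' k l := Germ.ext (hu.map_add k.1 l.1)

/-- The `n`-th component of the map with linear part `u`. -/
def linearTerm (A B : TotalCMon C) (s : X ⟶ Y) (u : A.carrier ⟶ B.carrier) (n : ℕ) (hn : 0 < n) :
    pow A.carrier X n ⟶ B.carrier :=
  rs (projLast A.carrier X n ≫ s) ≫
    if n = 1 then proj A.carrier X ⟨0, hn⟩ ≫ u else B.homZero (pow A.carrier X n)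

lemma rs_linearTerm (s : X ⟶ Y) {u : A.carrier ⟶ B.carrier} (hu : IsTotalHom A B u) (n : ℕ)
    (hn : 0 < n) : rs (linearTerm A B s u n hn) = rs (projLast A.carrier X n ≫ s) := by
  refine (below_of_total _ ?_).rs_restrict
  split_ifs
  · exact total_comp (proj_total _ _ _) hu.total
  · exact homZero_total _ _

lemma tuple_rs_projLast {Z W : C} {n : ℕ} {e : Z ⟶ W} {x : Z ⟶ X} {s : X ⟶ Y} (hx : rs x = rs e)
    (hs : rs (x ≫ s) = rs e) (a : Fin n → Germ A e) {D : C} (K : pow A.carrier X n ⟶ D) :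
    tuple (fun i => (a i).1) x ≫ rs (projLast A.carrier X n ≫ s) ≫ K =
      tuple (fun i => (a i).1) x ≫ K := by
  have h : rs (tuple (fun i => (a i).1) x) = rs e := rs_tuple (fun i => (a i).2) hx
  have h₁ : rs (tuple (fun i => (a i).1) x ≫ projLast A.carrier X n ≫ s) = rs e := by
    rw [← Category.assoc, tuple_projLast, Category.assoc, rs_rs_comp, h, hs, rs_idem]
  rw [← Category.assoc, comp_rs, h₁, ← h, rs_comp_self]

lemma tuple_linearTerm {s : X ⟶ Y} {u : A.carrier ⟶ B.carrier} (hu : IsTotalHom A B u) {n : ℕ}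
    (hn : 0 < n) {Z W : C} {e : Z ⟶ W} {x : Z ⟶ X} (hx : rs x = rs e) (hs : rs (x ≫ s) = rs e)
    (a : Fin n → Germ A e) :
    tuple (fun i => (a i).1) x ≫ linearTerm A B s u n hn =
      ((SymSeries.linear (hu.germ e)).term n a).1 := by
  have h : rs (tuple (fun i => (a i).1) x) = rs e := rs_tuple (fun i => (a i).2) hx
  rw [linearTerm, tuple_rs_projLast hx hs]
  split_ifs with h1
  · subst h1
    rw [← Category.assoc, tuple_proj, h, ← (a _).2, rs_comp_self]
    rfl
  · rw [SymSeries.linear_term_of_ne _ _ h1, comp_homZero, h]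
    rfl

end linear

namespace FaaHom

variable {P Q R : FaaObj C}

/-- The map with linear part `u` over `s`. -/
def linear (s : P.pt ⟶ Q.pt) (u : P.vec.carrier ⟶ Q.vec.carrier)
    (hu : IsTotalHom P.vec Q.vec u) : FaaHom P Q where
  star := s
  term := linearTerm P.vec Q.vec s u
  rs_term := rs_linearTerm s hu
  symmetric n hn := isSymmetric_of_germ (rs_linearTerm s hu n hn) fun _ _ hx hs =>
    ⟨_, tuple_linearTerm hu hn hx hs⟩
  additive n hn := isAdditive_of_germ (rs_linearTerm s hu n hn) fun _ _ hx hs =>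
    ⟨_, tuple_linearTerm hu hn hx hs⟩

lemma linear_series (s : P.pt ⟶ Q.pt) (u : P.vec.carrier ⟶ Q.vec.carrier)
    (hu : IsTotalHom P.vec Q.vec u) {Z W : C} (e : Z ⟶ W) (x : Z ⟶ P.pt)
    (hx : rs x = rs e) (hs : rs (x ≫ (linear s u hu).star) = rs e) :
    (linear s u hu).series e x hx hs = SymSeries.linear (hu.germ e) := by
  apply SymSeries.ext
  funext n
  ext a : 1
  rcases Nat.eq_zero_or_pos n with rfl | hn
  · rfl
  · exact Germ.ext ((val_series_term _ e x hx hs n hn a).trans (tuple_linearTerm hu hn hx hs a))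

/-- Postcomposition with a linear map. -/
lemma comp_linear_term (f : FaaHom P Q) (s : Q.pt ⟶ R.pt) (u : Q.vec.carrier ⟶ R.vec.carrier)
    (hu : IsTotalHom Q.vec R.vec u) (n : ℕ) (hn : 0 < n) :
    (comp f (linear s u hu)).term n hn =
      rs (projLast P.vec.carrier P.pt n ≫ f.star ≫ s) ≫ f.term n hn ≫ u := by
  refine eq_of_germ (s := f.star ≫ s) (rs_compTerm _ _ _ _) ?_ fun e x hx hs a => ?_
  · have h : rs (f.term n hn ≫ u) = rs (projLast P.vec.carrier P.pt n ≫ f.star) :=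
      (rs_comp_total _ hu.total).trans (f.rs_term n hn)
    refine Below.rs_restrict ((congrArg _ h).trans ?_)
    rw [← Category.assoc, rs_comp_le]
  · have hf := rs_comp_star_left hx hs
    have hs' : rs ((x ≫ f.star) ≫ (linear s u hu).star) = rs e := by
      rw [Category.assoc]; exact hs
    have key : (((linear s u hu).series e (x ≫ f.star) hf hs').comp (f.series e x hx hf)).term n a =
        hu.germ e ((f.series e x hx hf).term n a) := by
      rw [linear_series, SymSeries.comp_of_linear_left (SymSeries.linear_term_of_ne _) _ hn,
        SymSeries.linear_term_one]
    refine (tuple_compTerm f _ e x hx hf hs' n hn a).trans ((congrArg Germ.val key).trans ?_)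
    refine Eq.trans ?_ (tuple_rs_projLast hx hs a (f.term n hn ≫ u)).symm
    refine Eq.trans ?_ (Category.assoc _ _ _)
    exact congrArg (· ≫ u) (val_series_term f e x hx hf n hn a)

lemma isTotalHom_id (A : TotalCMon C) : IsTotalHom A A (𝟙 A.carrier) where
  total := rs_id _
  map_add a b := by simp only [Category.comp_id]
  map_zero Z := Category.comp_id _

/-- The restriction of the identity to the domain of definition of `t`. -/
def restr (P : FaaObj C) {Y : C} (t : P.pt ⟶ Y) : FaaHom P P :=
  linear (rs t) (𝟙 P.vec.carrier) (isTotalHom_id P.vec)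

lemma restr_series {Y : C} (t : P.pt ⟶ Y) {Z W : C} (e : Z ⟶ W) (x : Z ⟶ P.pt)
    (hx : rs x = rs e) (hs : rs (x ≫ (restr P t).star) = rs e) :
    (restr P t).series e x hx hs = SymSeries.linear ((isTotalHom_id P.vec).germ e) :=
  linear_series _ _ _ _ _ _ _

lemma restr_term (P : FaaObj C) {Y : C} (t : P.pt ⟶ Y) (n : ℕ) (hn : 0 < n) :
    (restr P t).term n hn = rs (projLast P.vec.carrier P.pt n ≫ t) ≫
      if n = 1 then proj P.vec.carrier P.pt ⟨0, hn⟩ else P.vec.homZero (P.src n) := by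
  change rs _ ≫ (if n = 1 then _ ≫ 𝟙 _ else _) = _
  rw [Category.comp_id, rs_comp_rs]
  rfl

/-- At a point `x` where `t` is defined, `x ≫ rs t = x` and the series of `restr P t` is the
identity. Precomposition therefore only cuts down the domain. -/
lemma restr_comp_term {Y : C} (t : P.pt ⟶ Y) (g : FaaHom P Q) (n : ℕ) (hn : 0 < n) :
    (comp (restr P t) g).term n hn = rs (projLast P.vec.carrier P.pt n ≫ t) ≫ g.term n hn := by
  refine eq_of_germ (s := rs t ≫ g.star) (rs_compTerm _ _ _ _) ?_ fun e x hx hs a => ?_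
  · refine (rs_rs_comp _ _).trans ((congrArg _ (g.rs_term n hn)).trans ?_)
    have h : projLast P.vec.carrier P.pt n ≫ rs t ≫ g.star =
        rs (projLast P.vec.carrier P.pt n ≫ t) ≫ projLast P.vec.carrier P.pt n ≫ g.star := by
      rw [← Category.assoc, comp_rs, Category.assoc]
    rw [h, rs_rs_comp]
  · have hf : rs (x ≫ (restr P t).star) = rs e :=
      rs_comp_star_left (f := restr P t) (g := g.star) hx hs
    have ht : rs (x ≫ t) = rs e := by rw [← rs_comp_rs]; exact hf
    have hx' : x ≫ (restr P t).star = x := by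
      change x ≫ rs t = x
      rw [comp_rs, ht, ← hx, rs_comp_self]
    have hs' : rs ((x ≫ (restr P t).star) ≫ g.star) = rs e := by
      rw [Category.assoc]; exact hs
    have hg : rs (x ≫ g.star) = rs e := by rwa [hx'] at hs'
    have key : ((g.series e (x ≫ (restr P t).star) hf hs').comp
        ((restr P t).series e x hx hf)).term n a = (g.series e x hx hg).term n a := by
      rw [g.series_congr hx' hf hs' hx hg, restr_series,
        SymSeries.comp_of_linear_right _ (SymSeries.linear_term_of_ne _)]
      congr 1
      funext i
      exact Germ.ext (Category.comp_id _)
    refine (tuple_compTerm _ g e x hx hf hs' n hn a).trans ((congrArg Germ.val key).trans ?_)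
    exact (val_series_term g e x hx hg n hn a).trans
      (tuple_rs_projLast hx ht a (g.term n hn)).symm

lemma restr_comp_of_star_eq {Y : C} (t : P.pt ⟶ Y) (f g : FaaHom P Q)
    (h : rs t ≫ g.star = f.star)
    (H : ∀ n hn, rs (projLast P.vec.carrier P.pt n ≫ t) ≫ g.term n hn = f.term n hn) :
    comp (restr P t) g = f :=
  FaaHom.ext h (funext fun n => funext fun hn => (restr_comp_term t g n hn).trans (H n hn))

lemma id_comp (f : FaaHom P Q) : comp (restr P (𝟙 P.pt)) f = f := by
  refine restr_comp_of_star_eq _ _ _ ?_ fun n hn => ?_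
  · rw [rs_id, Category.id_comp]
  · rw [Category.comp_id, show rs _ = _ from projLast_total _ _ _]
    exact Category.id_comp _

lemma comp_restr_term (f : FaaHom P Q) {Y : C} (t : Q.pt ⟶ Y) (n : ℕ) (hn : 0 < n) :
    (comp f (restr Q t)).term n hn =
      rs (projLast P.vec.carrier P.pt n ≫ f.star ≫ t) ≫ f.term n hn := by
  refine (comp_linear_term f _ _ _ n hn).trans ?_
  refine congrArg₂ (· ≫ ·) ?_ (Category.comp_id _)
  rw [← Category.assoc, rs_comp_rs, Category.assoc]

lemma comp_id (f : FaaHom P Q) : comp f (restr Q (𝟙 Q.pt)) = f := by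
  refine FaaHom.ext ?_ (funext fun n => funext fun hn => ?_)
  · change f.star ≫ rs _ = _
    rw [rs_id, Category.comp_id]
  · rw [comp_restr_term, Category.comp_id, ← f.rs_term n hn]
    exact rs_comp_self _

end FaaHom

/-! ### Additivity of pairings and projections -/

section pairs

variable {A M N : TotalCMon C} {X : C} {n : ℕ}

lemma homAdd_pair {Z : C} (a b : Z ⟶ M.carrier) (c d : Z ⟶ N.carrier) :
    (M.prod N).homAdd (pair a c) (pair b d) = pair (M.homAdd a b) (N.homAdd c d) := by
  refine (pair_ex_map M N (pair a c) (pair b d)).trans ?_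
  rw [pair_fst, pair_snd, pair_fst, pair_snd, TotalCMon.homAdd, TotalCMon.homAdd, pair_rs_left,
    pair_rs_right, pair_rs_left, pair_rs_right]
  simp only [Category.assoc]
  rw [← Category.assoc (rs c), ← rs_pair, ← Category.assoc (rs a), ← rs_pair]
  exact pair_absorb _ _ _ _ (rs_comp_total _ N.add_total).symm (rs_comp_total _ M.add_total).symm

lemma homZero_prod (Z : C) :
    (M.prod N).homZero Z = pair (M.homZero Z) (N.homZero Z) :=
  comp_pair _ _ _

lemma IsSymmetric.pair {B D : C} {K : pow A.carrier X n ⟶ B} {L : pow A.carrier X n ⟶ D}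
    (hK : IsSymmetric K) (hL : IsSymmetric L) : IsSymmetric (pair K L) := by
  intro σ Z a x
  rw [comp_pair, comp_pair, hK, hL]

lemma IsAdditive.pair {K : pow A.carrier X n ⟶ M.carrier} {L : pow A.carrier X n ⟶ N.carrier}
    (hK : IsAdditive A M K) (hL : IsAdditive A N L) :
    IsAdditive A (M.prod N) (CartesianStructure.pair K L) := by
  constructor
  · intro Z a x i b
    refine (comp_pair _ _ _).trans ?_
    rw [hK.1, hL.1, ← homAdd_pair, ← comp_pair, ← comp_pair]
    rfl
  · intro Z a x i
    refine (comp_pair _ _ _).trans ?_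
    rw [hK.2, hL.2, homZero_prod, pair_rs_left, pair_rs_right, ← Category.assoc, ← rs_pair,
      ← comp_pair]
    rfl

/-- Used to cancel the restriction that projecting a pair of sums leaves behind. -/
lemma rs_homAdd_fst_eq_snd {Z : C} (a b : Z ⟶ prod M.carrier N.carrier) :
    rs (M.homAdd (a ≫ fst _ _) (b ≫ fst _ _)) = rs (N.homAdd (a ≫ snd _ _) (b ≫ snd _ _)) := by
  rw [M.rs_homAdd, N.rs_homAdd, rs_comp_total _ (fst_total _ _), rs_comp_total _ (fst_total _ _),
    rs_comp_total _ (snd_total _ _), rs_comp_total _ (snd_total _ _)]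

lemma isTotalHom_fst (M N : TotalCMon C) : IsTotalHom (M.prod N) M (fst M.carrier N.carrier) where
  total := fst_total _ _
  map_add a b := by
    refine (congrArg (· ≫ fst _ _) (pair_ex_map M N a b)).trans ((pair_fst _ _).trans ?_)
    exact (congrArg (· ≫ _) (rs_homAdd_fst_eq_snd a b).symm).trans (rs_comp_self _)
  map_zero Z := by
    rw [homZero_prod]
    exact pair_fst_of_total _ (homZero_total N Z)

lemma isTotalHom_snd (M N : TotalCMon C) : IsTotalHom (M.prod N) N (snd M.carrier N.carrier) where
  total := snd_total _ _
  map_add a b := by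
    refine (congrArg (· ≫ snd _ _) (pair_ex_map M N a b)).trans ((pair_snd _ _).trans ?_)
    exact (congrArg (· ≫ _) (rs_homAdd_fst_eq_snd a b)).trans (rs_comp_self _)
  map_zero Z := by
    rw [homZero_prod]
    exact pair_snd_of_total _ (homZero_total M Z)

end pairs

end CartRes

namespace CartRes

open Restriction CartesianStructure RestrictionCategory CartesianRestrictionCategory

variable {C : Type u} [Category.{v} C] [Restriction C] [CartesianStructure C]
  [CartesianRestrictionCategory C]

/-! ### Terminal object, products and the operations -/

/-- A map to the terminal object carries no information beyond its domain, so laws for such maps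
reduce to equations of restrictions. -/
lemma eq_of_rs_eq {Z : C} {k l : Z ⟶ (one : C)} (h : rs k = rs l) : k = l := by
  rw [eq_rs_bang k, eq_rs_bang l, h]

lemma isTotalHom_bang (A : TotalCMon C) : IsTotalHom A (TotalCMon.unit C) (bang A.carrier) where
  total := bang_total _
  map_add a b := eq_of_rs_eq (by
    refine ((rs_comp_total _ (bang_total _)).trans (A.rs_homAdd a b)).trans ?_
    refine Eq.trans ?_ (TotalCMon.rs_homAdd (TotalCMon.unit C) (a ≫ bang A.carrier)
      (b ≫ bang A.carrier)).symm
    exact congrArg₂ (· ≫ ·) (rs_comp_total a (bang_total _)).symm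
      (rs_comp_total b (bang_total _)).symm)
  map_zero Z := eq_of_rs_eq
    ((total_comp (homZero_total _ _) (bang_total _)).trans (homZero_total _ _).symm)

namespace FaaHom

variable {P Q R S : FaaObj C}

lemma linear_term_of_total {s : P.pt ⟶ Q.pt} (hs : IsTotal s) (u : P.vec.carrier ⟶ Q.vec.carrier)
    (hu : IsTotalHom P.vec Q.vec u) (n : ℕ) (hn : 0 < n) : (linear s u hu).term n hn =
      if n = 1 then proj P.vec.carrier P.pt ⟨0, hn⟩ ≫ u else Q.vec.homZero (P.src n) := by
  refine (congrArg (· ≫ _) (total_comp (projLast_total _ _ n) hs)).trans ?_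
  exact Category.id_comp _

/-- The map to the terminal object. -/
def bang (P : FaaObj C) : FaaHom P (FaaObj.unit C) :=
  linear (CartesianStructure.bang P.pt) (CartesianStructure.bang P.vec.carrier)
    (isTotalHom_bang P.vec)

lemma bang_term (P : FaaObj C) (n : ℕ) (hn : 0 < n) :
    (bang P).term n hn = CartesianStructure.bang (P.src n) :=
  bang_unique _ (((bang P).rs_term n hn).trans
    (total_comp (projLast_total _ _ n) (bang_total _)))

/-- The first projection. -/
def fst (P Q : FaaObj C) : FaaHom (P.prod Q) P :=
  linear (CartesianStructure.fst P.pt Q.pt) (CartesianStructure.fst P.vec.carrier Q.vec.carrier)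
    (isTotalHom_fst P.vec Q.vec)

/-- The second projection. -/
def snd (P Q : FaaObj C) : FaaHom (P.prod Q) Q :=
  linear (CartesianStructure.snd P.pt Q.pt) (CartesianStructure.snd P.vec.carrier Q.vec.carrier)
    (isTotalHom_snd P.vec Q.vec)

/-- The pairing of two maps. -/
def pair (f : FaaHom S P) (g : FaaHom S Q) : FaaHom S (P.prod Q) where
  star := CartesianStructure.pair f.star g.star
  term n hn := CartesianStructure.pair (f.term n hn) (g.term n hn)
  rs_term n hn := by
    refine (rs_pair _ _).trans ((congrArg₂ (· ≫ ·) (f.rs_term n hn) (g.rs_term n hn)).trans ?_)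
    exact ((congrArg rs (comp_pair _ f.star g.star)).trans (rs_pair _ _)).symm
  symmetric n hn := (f.symmetric n hn).pair (g.symmetric n hn)
  additive n hn := (f.additive n hn).pair (g.additive n hn)

/-- The operations of the Faà di Bruno category. -/
noncomputable def operations (C : Type u) [Category.{v} C] [Restriction C] [CartesianStructure C]
    [CartesianRestrictionCategory C] : FaaOperations C where
  id P := restr P (𝟙 P.pt)
  id_star P := rs_id P.pt
  id_term P n hn := by
    rw [restr_term, Category.comp_id, show rs (projLast _ _ n) = _ from projLast_total _ _ n]
    exact Category.id_comp _
  comp := comp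
  comp_star _ _ := rfl
  comp_term _ _ _ _ := rfl
  res f := restr _ f.star
  res_star _ := rfl
  res_term f := restr_term _ f.star
  bang := bang
  bang_star _ := rfl
  bang_term := bang_term
  fst := fst
  fst_star _ _ := rfl
  fst_term _ _ := linear_term_of_total (fst_total _ _) _ _
  snd := snd
  snd_star _ _ := rfl
  snd_term _ _ := linear_term_of_total (snd_total _ _) _ _
  pair := pair
  pair_star _ _ := rfl
  pair_term _ _ _ _ := rfl

lemma isCategory_operations : (operations C).IsCategory where
  id_comp := id_comp
  comp_id := comp_id
  assoc := comp_assoc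

/-! ### The Cartesian restriction axioms -/

lemma restr_congr {Y V : C} {s : P.pt ⟶ Y} {t : P.pt ⟶ V} (h : rs s = rs t) :
    restr P s = restr P t := by
  simp only [restr, h]

lemma restr_comp_self (f : FaaHom P Q) : comp (restr P f.star) f = f := by
  refine restr_comp_of_star_eq _ _ _ (rs_comp_self _) fun n hn => ?_
  rw [← f.rs_term n hn]
  exact rs_comp_self _

lemma restr_comp_restr {Y V : C} (s : P.pt ⟶ Y) (t : P.pt ⟶ V) :
    comp (restr P s) (restr P t) = restr P (rs s ≫ t) := by
  refine restr_comp_of_star_eq _ _ _ (rs_rs_comp s t).symm fun n hn => ?_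
  have h : projLast P.vec.carrier P.pt n ≫ rs s ≫ t =
      rs (projLast P.vec.carrier P.pt n ≫ s) ≫ projLast P.vec.carrier P.pt n ≫ t := by
    rw [← Category.assoc, comp_rs, Category.assoc]
  rw [restr_term, restr_term, h, rs_rs_comp]
  exact (Category.assoc _ _ _).symm

lemma restr_comm {Y V : C} (s : P.pt ⟶ Y) (t : P.pt ⟶ V) :
    comp (restr P s) (restr P t) = comp (restr P t) (restr P s) := by
  rw [restr_comp_restr, restr_comp_restr]
  exact restr_congr (by rw [rs_rs_comp, rs_rs_comp, rs_comm])

/-- On both sides the components are those of `f`, restricted to where `f.star ≫ t` is defined at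
the last projection. -/
lemma comp_restr (f : FaaHom P Q) {Y : C} (t : Q.pt ⟶ Y) :
    comp f (restr Q t) = comp (restr P (f.star ≫ t)) f := by
  refine (restr_comp_of_star_eq _ _ _ (comp_rs _ _).symm fun n hn => ?_).symm
  exact (comp_restr_term f t n hn).symm

/-- `star` fixes the domain of every component, and a component with values in the terminal object
is fixed by its domain. -/
lemma ext_unit {f g : FaaHom P (FaaObj.unit C)} (h : f.star = g.star) : f = g :=
  FaaHom.ext h (funext fun n => funext fun hn =>
    eq_of_rs_eq ((f.rs_term n hn).trans (h ▸ (g.rs_term n hn).symm)))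

lemma restr_of_total {Y : C} {t : P.pt ⟶ Y} (h : IsTotal t) : restr P t = restr P (𝟙 P.pt) :=
  restr_congr (Eq.trans h (rs_id _).symm)

lemma isTotal_star {f : FaaHom P Q} (h : restr P f.star = restr P (𝟙 P.pt)) : IsTotal f.star :=
  (congrArg FaaHom.star h).trans (rs_id _)

lemma rs_star_comp_total (f : FaaHom P Q) {Y : C} {s : Q.pt ⟶ Y} (hs : IsTotal s) (n : ℕ)
    (hn : 0 < n) :
    rs (projLast P.vec.carrier P.pt n ≫ f.star ≫ s) = rs (f.term n hn) := by
  rw [← Category.assoc, rs_comp_total _ hs, ← f.rs_term n hn]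

lemma comp_linear_term_of_total (f : FaaHom P Q) {s : Q.pt ⟶ R.pt} (hs : IsTotal s)
    (u : Q.vec.carrier ⟶ R.vec.carrier) (hu : IsTotalHom Q.vec R.vec u) (n : ℕ) (hn : 0 < n) :
    (comp f (linear s u hu)).term n hn = f.term n hn ≫ u := by
  refine (comp_linear_term f _ _ _ n hn).trans ?_
  rw [f.rs_star_comp_total hs n hn]
  exact (Category.assoc _ _ _).symm.trans (congrArg (· ≫ u) (rs_comp_self _))

lemma restr_comp_eq_pair_fst (f : FaaHom S P) (g : FaaHom S Q) :
    comp (restr S ((pair f g).star ≫ CartesianStructure.fst P.pt Q.pt)) f =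
      comp (pair f g) (fst P Q) := by
  refine restr_comp_of_star_eq _ _ _ (pair_fst_le f.star g.star) fun n hn => ?_
  refine Eq.trans ?_ (comp_linear_term_of_total (pair f g) (fst_total _ _) _ _ n hn).symm
  refine Eq.trans ?_ (pair_fst (f.term n hn) (g.term n hn)).symm
  refine (congrArg (· ≫ _) ((rs_star_comp_total (pair f g) (fst_total _ _) n hn).trans
    ((rs_pair (f.term n hn) (g.term n hn)).trans (rs_comm _ _)))).trans ?_
  exact (Category.assoc _ _ _).trans (congrArg _ (rs_comp_self _))

lemma restr_comp_eq_pair_snd (f : FaaHom S P) (g : FaaHom S Q) :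
    comp (restr S ((pair f g).star ≫ CartesianStructure.snd P.pt Q.pt)) g =
      comp (pair f g) (snd P Q) := by
  refine restr_comp_of_star_eq _ _ _ (pair_snd_le f.star g.star) fun n hn => ?_
  refine Eq.trans ?_ (comp_linear_term_of_total (pair f g) (snd_total _ _) _ _ n hn).symm
  refine Eq.trans ?_ (pair_snd (f.term n hn) (g.term n hn)).symm
  refine (congrArg (· ≫ _) ((rs_star_comp_total (pair f g) (snd_total _ _) n hn).trans
    (rs_pair (f.term n hn) (g.term n hn)))).trans ?_
  exact (Category.assoc _ _ _).trans (congrArg _ (rs_comp_self _))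

/-- Composing with `fst P Q` or `snd P Q` applies a total projection to each component, so
uniqueness follows componentwise from `prod_ext`. -/
lemma pair_unique (f : FaaHom S P) (g : FaaHom S Q) (h : FaaHom S (P.prod Q))
    (hf : comp (restr S (h.star ≫ CartesianStructure.fst P.pt Q.pt)) f = comp h (fst P Q))
    (hg : comp (restr S (h.star ≫ CartesianStructure.snd P.pt Q.pt)) g = comp h (snd P Q))
    (hfg : restr S h.star = comp (restr S f.star) (restr S g.star)) : h = pair f g := by
  have hs : h.star = (pair f g).star :=
    CartesianRestrictionCategory.pair_unique f.star g.star h.star (congrArg FaaHom.star hf)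
      (congrArg FaaHom.star hg) (congrArg FaaHom.star hfg)
  -- Once the `star` parts agree, `hf` and `hg` say that `h` and `pair f g` have the same composites
  -- with the projections.
  rw [hs, restr_comp_eq_pair_fst] at hf
  rw [hs, restr_comp_eq_pair_snd] at hg
  refine FaaHom.ext hs (funext fun n => funext fun hn => ?_)
  have hf' := congrArg (fun k => k.term n hn) hf
  have hg' := congrArg (fun k => k.term n hn) hg
  refine prod_ext (X := P.vec.carrier) (Y := Q.vec.carrier) ?_ ?_
  · exact (comp_linear_term_of_total h (fst_total _ _) _ _ n hn).symm.trans
      (hf'.symm.trans (comp_linear_term_of_total (pair f g) (fst_total _ _) _ _ n hn))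
  · exact (comp_linear_term_of_total h (snd_total _ _) _ _ n hn).symm.trans
      (hg'.symm.trans (comp_linear_term_of_total (pair f g) (snd_total _ _) _ _ n hn))

lemma restr_pair (f : FaaHom S P) (g : FaaHom S Q) :
    restr S (pair f g).star = comp (restr S f.star) (restr S g.star) := by
  rw [restr_comp_restr]
  exact restr_congr ((rs_pair f.star g.star).trans (rs_rs_comp _ _).symm)

end FaaHom

end CartRes

theorem mainTheorem7 {C : Type u} [Category.{v} C] [Restriction C] [CartesianStructure C]
    [CartesianRestrictionCategory C] :
    ∃ (S : FaaOperations C) (h : S.IsCategory),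
      letI : Category.{v} (FaaObj C) := S.category h
      letI : Restriction (FaaObj C) := S.restriction h
      letI : CartesianStructure (FaaObj C) := S.cartesian h
      CartesianRestrictionCategory (FaaObj C) := by
  refine ⟨FaaHom.operations C, FaaHom.isCategory_operations, ?_⟩
  let _ : Category.{v} (FaaObj C) :=
    (FaaHom.operations C).category FaaHom.isCategory_operations
  let _ : Restriction (FaaObj C) :=
    (FaaHom.operations C).restriction FaaHom.isCategory_operations
  let _ : CartesianStructure (FaaObj C) :=
    (FaaHom.operations C).cartesian FaaHom.isCategory_operations
  exact
    { rs_comp_self := fun f => FaaHom.restr_comp_self f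
      rs_comm := fun f g => FaaHom.restr_comm f.star g.star
      rs_rs_comp := fun f g => (FaaHom.restr_comp_restr f.star g.star).symm
      comp_rs := fun f g => FaaHom.comp_restr f g.star
      bang_total := fun P => FaaHom.restr_of_total (CartesianRestrictionCategory.bang_total P.pt)
      bang_unique := fun f hf => FaaHom.ext_unit
        (CartesianRestrictionCategory.bang_unique f.star (FaaHom.isTotal_star hf))
      comp_bang := fun f => FaaHom.ext_unit (CartesianRestrictionCategory.comp_bang f.star)
      fst_total := fun P Q =>
        FaaHom.restr_of_total (CartesianRestrictionCategory.fst_total P.pt Q.pt)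
      snd_total := fun P Q =>
        FaaHom.restr_of_total (CartesianRestrictionCategory.snd_total P.pt Q.pt)
      pair_fst_le := fun f g => FaaHom.restr_comp_eq_pair_fst f g
      pair_snd_le := fun f g => FaaHom.restr_comp_eq_pair_snd f g
      rs_pair := fun f g => FaaHom.restr_pair f g
      pair_unique := fun f g h => FaaHom.pair_unique f g h }
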